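/- Let $r\ge 1$ be an integer and let ${\cal A}_r$ be the Cayley-Dickson algebra of real dimension $2^r$, with ${\cal A}_0=\mathbf R$ and doubling $(\xi+\eta l)(\gamma+\delta l)=(\xi\gamma-\delta^*\eta)+(\delta\xi+\eta\gamma^*)l$, $(\xi+\eta l)^*=\xi^*-\eta l$, standard generators $i_0=1,i_1,\dots,i_{2^r-1}$ (with $l=i_{2^{r-1}}$ and $i_jl=i_{2^{r-1}+j}$ when doubling ${\cal A}_{r-1}$ to ${\cal A}_r$), elements $z=\sum_j z_ji_j$ ($z_j\in\mathbf R$), $\mathrm{Re}\,z=z_0$, $|z|^2=\sum_j z_j^2$, and $\exp z=\sum_{k\ge0}z^k/k!$. Let $2^{r-1}\le n\le 2^r-1$, let $a_1<a_{-1}$ be real numbers, and let $f:\mathbf R^n\to{\cal A}_r$ satisfy: (1) $f$ is continuous at Lebesgue-almost every point of $\mathbf R^n$; (2) each partial function $g_j(t_j)=f(t_1,\dots,t_n)$ (the other variables being fixed) has on every bounded interval only finitely many points of discontinuity, all of the first kind (finite one-sided limits exist there); (3) for each $t\in\mathbf R^n$ and each $j$ such that $g_j$ is continuous at $t_j$ there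 are constants $A_j>0$, $0<\alpha_j\le1$, $\delta_j>0$ (depending on $t$) with $|g_j(t_j+h)-g_j(t_j)|\le A_j|h|^{\alpha_j}$ whenever $|h|<\delta_j$; (4) for each $v\in\{-1,1\}^n$ there is a constant $C_v>0$ with $|f(t)|<C_v\exp\big(\sum_{j=1}^n a_{v_j}t_j\big)$ for all $t\in\mathbf R^n$ such that $v_jt_j\ge0$ for every $j$. For $t\in\mathbf R^n$ put $t_j=0$ for $n<j\le 2^r-1$ and $s_j=t_j+\dots+t_{2^r-1}$. Let $u$ be given either in Cartesian coordinates by $$u(p,t;\zeta)=p_0(t_1+\dots+t_{2^r-1})+\sum_{j=1}^{2^r-1}p_jt_ji_j+\zeta ,$$ or in spherical coordinates by $u(p,t;\zeta)=p_0s_1+M(p,t;\zeta)+\zeta_0$, where, with $\theta_j=p_js_j+\zeta_j$, $$M=\theta_1\Big[\sum_{k=1}^{2^r-2}i_k\Big(\prod_{j=2}^{k}\sin\theta_j\Big)\cos\theta_{k+1}+i_{2^r-1}\prod_{j=2}^{2^r-1}\sin\theta_j\Big].$$ Call a function $g$ with values in ${\cal A}_r$ *${\cal A}_r$-holomorphic*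 (locally analytic) on an open set $U\subset{\cal A}_r$ if near every $z_0\in U$ it is the sum of a normally convergent series $g(z)=\sum_{k\ge0}P_k(z-z_0)$, where each $P_k(h)$ is a finite sum of words of degree $k$, that is, of bracketed products (in any order and with any placement of brackets) of constants from ${\cal A}_r$ and exactly $k$ factors $h$. Then, for every $p\in{\cal A}_r$ with $a_1<\mathrm{Re}\,p<a_{-1}$ and every $\zeta\in{\cal A}_r$, the integral $${\cal F}^n(f,u;p;\zeta)=\int_{\mathbf R^n}f(t)\exp(-u(p,t;\zeta))\,dt$$ converges absolutely. For each $\zeta\in{\cal A}_r$ it is ${\cal A}_r$-holomorphic in $p$ on the domain $\{p\in{\cal A}_r: a_1<\mathrm{Re}\,p<a_{-1}\}$, and for each $p$ in this domain it is ${\cal A}_r$-holomorphic in $\zeta$ on ${\cal A}_r$. -/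

import Mathlib

open MeasureTheory Filter Topology

noncomputable section

/-- The Cayley-Dickson algebra `A_r` as a Euclidean space: `z = ∑ z_j i_j`, `0 ≤ j < 2 ^ r`,
with `|z| ^ 2 = ∑ z_j ^ 2`.  Its multiplication is `CD.mul` below. -/
abbrev CD (r : ℕ) : Type := EuclideanSpace ℝ (Fin (2 ^ r))

namespace CD

/-- `ξ` in `z = ξ + η l ∈ A_{r+1}`, where `l = i_{2^r}` and `i_j l = i_{2^r + j}`. -/
def lo {r : ℕ} (x : Fin (2 ^ (r + 1)) → ℝ) : Fin (2 ^ r) → ℝ :=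
  fun j => x ⟨j.1, by have := j.2; rw [pow_succ]; omega⟩

/-- `η` in `z = ξ + η l ∈ A_{r+1}`. -/
def hi {r : ℕ} (x : Fin (2 ^ (r + 1)) → ℝ) : Fin (2 ^ r) → ℝ :=
  fun j => x ⟨j.1 + 2 ^ r, by have := j.2; rw [pow_succ]; omega⟩

/-- The coordinates of `ξ + η l` from those of `ξ` and `η`. -/
def join {r : ℕ} (x y : Fin (2 ^ r) → ℝ) : Fin (2 ^ (r + 1)) → ℝ :=
  fun j => if h : j.1 < 2 ^ r then x ⟨j.1, h⟩
    else y ⟨j.1 - 2 ^ r, by have h2 := j.2; have h3 := pow_succ 2 r; omega⟩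

/-- Conjugation in coordinates: the identity on `A_0 = ℝ`, and `(ξ + η l)^* = ξ^* - η l`. -/
def conjAux : (r : ℕ) → (Fin (2 ^ r) → ℝ) → (Fin (2 ^ r) → ℝ)
  | 0, x => x
  | r + 1, x => join (conjAux r (lo x)) (-hi x)

/-- Multiplication in coordinates, by the doubling procedure
`(ξ + η l)(γ + δ l) = (ξ γ - δ^* η) + (δ ξ + η γ^*) l`, starting from `A_0 = ℝ`. -/
def mulAux : (r : ℕ) → (Fin (2 ^ r) → ℝ) → (Fin (2 ^ r) → ℝ) → (Fin (2 ^ r) → ℝ)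
  | 0, x, y => fun j => x j * y j
  | r + 1, x, y =>
      join (mulAux r (lo x) (lo y) - mulAux r (conjAux r (hi y)) (hi x))
        (mulAux r (hi y) (lo x) + mulAux r (hi x) (conjAux r (lo y)))

/-- The product of the Cayley-Dickson algebra `A_r`. -/
def mul {r : ℕ} (x y : CD r) : CD r := WithLp.toLp 2 (mulAux r x.ofLp y.ofLp)

/-- The real coordinate `z_j` of `z = ∑ z_j i_j`  (zero if `j ≥ 2 ^ r`). -/
def coord {r : ℕ} (z : CD r) (j : ℕ) : ℝ := if h : j < 2 ^ r then z ⟨j, h⟩ else 0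

/-- The standard generator `i_j`, `0 ≤ j < 2 ^ r` (zero if `j ≥ 2 ^ r`). -/
def gen (r j : ℕ) : CD r := WithLp.toLp 2 (fun k => if k.1 = j then 1 else 0)

/-- Powers, `z ^ 0 = 1 = i_0` and `z ^ (k + 1) = z ^ k z`. -/
def npow {r : ℕ} (z : CD r) : ℕ → CD r
  | 0 => gen r 0
  | k + 1 => mul (npow z k) z

/-- The exponential function `exp z = ∑ z ^ k / k!` of `A_r`. -/
def exp {r : ℕ} (z : CD r) : CD r := ∑' k : ℕ, ((k.factorial : ℝ)⁻¹) • npow z k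

/-! ### Local analyticity over `A_r` -/

/-- Words in one variable over `A_r`: bracketed products of constants from `A_r` and copies of
the variable, in any order and with any placement of the brackets. -/
inductive Word (r : ℕ) : Type
  | const (a : CD r) : Word r
  | var : Word r
  | mul (w₁ w₂ : Word r) : Word r

/-- The value of a word at `h ∈ A_r`. -/
def Word.eval {r : ℕ} : Word r → CD r → CD r
  | .const a, _ => a
  | .var, h => h
  | .mul w₁ w₂, h => CD.mul (w₁.eval h) (w₂.eval h)

/-- The number of occurrences of the variable in a word. -/
def Word.degree {r : ℕ} : Word r → ℕ
  | .const _ => 0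
  | .var => 1
  | .mul w₁ w₂ => w₁.degree + w₂.degree

/-- The homogeneous polynomials of degree `k` over `A_r`: finite sums of words of degree `k`. -/
def homPoly (r k : ℕ) : Submodule ℝ (CD r → CD r) :=
  Submodule.span ℝ {P | ∃ w : Word r, w.degree = k ∧ P = w.eval}

/-- `g` is `A_r`-holomorphic (locally analytic) on `U`: near every point `z₀` of `U` it is the sum
of a power series over `A_r` in `z - z₀`, converging normally on a neighbourhood of `z₀`. -/
def HolomorphicOn {r : ℕ} (g : CD r → CD r) (U : Set (CD r)) : Prop :=
  ∀ z₀ ∈ U, ∃ ρ > (0 : ℝ), ∃ P : ℕ → CD r → CD r, ∃ b : ℕ → ℝ,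
    (∀ k, P k ∈ homPoly r k) ∧ Summable b ∧
    (∀ k, ∀ h : CD r, ‖h‖ < ρ → ‖P k h‖ ≤ b k) ∧
    ∀ h : CD r, ‖h‖ < ρ → HasSum (fun k => P k h) (g (z₀ + h))

/-! ### Originals and images -/

/-- The partial function `s ↦ f (t_1, …, t_{j-1}, s, t_{j+1}, …, t_n)`. -/
def partialFun {r n : ℕ} (f : (Fin n → ℝ) → CD r) (t : Fin n → ℝ) (j : Fin n) : ℝ → CD r :=
  fun s => f (Function.update t j s)

/-- Function-originals `f : ℝⁿ → A_r` with growth exponents `a₁` (on positive half-axes) and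
`am₁ = a_{-1}` (on negative half-axes). -/
structure IsOriginal {r n : ℕ} (f : (Fin n → ℝ) → CD r) (a₁ am₁ : ℝ) : Prop where
  /-- continuity almost everywhere for the Lebesgue measure -/
  ae_continuous : ∀ᵐ t : Fin n → ℝ, ContinuousAt f t
  /-- every partial function has finitely many discontinuities on every bounded interval … -/
  finite_discont : ∀ (t : Fin n → ℝ) (j : Fin n) (c d : ℝ),
    {s : ℝ | s ∈ Set.Icc c d ∧ ¬ ContinuousAt (partialFun f t j) s}.Finite
  /-- … and all of them are of the first kind -/
  first_kind : ∀ (t : Fin n → ℝ) (j : Fin n) (s : ℝ), ¬ ContinuousAt (partialFun f t j) s →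
    (∃ l, Tendsto (partialFun f t j) (𝓝[<] s) (𝓝 l)) ∧
    (∃ l, Tendsto (partialFun f t j) (𝓝[>] s) (𝓝 l))
  /-- the pointwise Hölder condition away from the discontinuities -/
  holder : ∀ (t : Fin n → ℝ) (j : Fin n), ContinuousAt (partialFun f t j) (t j) →
    ∃ A > (0 : ℝ), ∃ α : ℝ, 0 < α ∧ α ≤ 1 ∧ ∃ δ > (0 : ℝ), ∀ h : ℝ, |h| < δ →
      ‖partialFun f t j (t j + h) - partialFun f t j (t j)‖ ≤ A * |h| ^ α
  /-- the growth bound on every orthant `v_j t_j ≥ 0` -/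
  growth : ∀ v : Fin n → ℤˣ, ∃ C > (0 : ℝ), ∀ t : Fin n → ℝ,
    (∀ j, 0 ≤ ((v j : ℤ) : ℝ) * t j) →
      ‖f t‖ < C * Real.exp (∑ j, (if v j = 1 then a₁ else am₁) * t j)

/-- The coordinate `t_j`, counted from `1`; `t_j = 0` for `j > n`. -/
def tc {n : ℕ} (t : Fin n → ℝ) (j : ℕ) : ℝ :=
  if h : 1 ≤ j ∧ j ≤ n then t ⟨j - 1, by omega⟩ else 0

/-- `s_j = t_j + … + t_n`; `s_j = 0` for `j > n`. -/
def sc {n : ℕ} (t : Fin n → ℝ) (j : ℕ) : ℝ := ∑ k ∈ Finset.Icc j n, tc t k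

/-- `u` in Cartesian coordinates:
`p_0 (t_1 + … + t_n) + ∑_{j=1}^{2^r-1} p_j t_j i_j + ζ`. -/
def uCart {r n : ℕ} (p : CD r) (t : Fin n → ℝ) (ζ : CD r) : CD r :=
  (coord p 0 * ∑ j ∈ Finset.Icc 1 n, tc t j) • gen r 0
    + ∑ j ∈ Finset.Icc 1 (2 ^ r - 1), (coord p j * tc t j) • gen r j + ζ

/-- The angle `p_j s_j + ζ_j`. -/
def angle {r n : ℕ} (p : CD r) (t : Fin n → ℝ) (ζ : CD r) (j : ℕ) : ℝ :=
  coord p j * sc t j + coord ζ j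

/-- With `θ_j = p_j s_j + ζ_j`, the purely imaginary number
`M = θ_1 [i_1 cos θ_2 + i_2 sin θ_2 cos θ_3 + … + i_{2^r-2} sin θ_2 ⋯ sin θ_{2^r-2} cos θ_{2^r-1}
+ i_{2^r-1} sin θ_2 ⋯ sin θ_{2^r-2} sin θ_{2^r-1}]`. -/
def sphM {r n : ℕ} (p : CD r) (t : Fin n → ℝ) (ζ : CD r) : CD r :=
  angle p t ζ 1 •
    (∑ k ∈ Finset.Icc 1 (2 ^ r - 2),
        ((∏ j ∈ Finset.Icc 2 k, Real.sin (angle p t ζ j)) * Real.cos (angle p t ζ (k + 1))) •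
          gen r k
      + (∏ j ∈ Finset.Icc 2 (2 ^ r - 1), Real.sin (angle p t ζ j)) • gen r (2 ^ r - 1))

/-- `u` in spherical coordinates: `p_0 s_1 + M + ζ_0`. -/
def uSph {r n : ℕ} (p : CD r) (t : Fin n → ℝ) (ζ : CD r) : CD r :=
  (coord p 0 * sc t 1) • gen r 0 + sphM p t ζ + coord ζ 0 • gen r 0

/-- The integrand `f(t) exp(-u(p,t;ζ))`. -/
def integrand {r n : ℕ} (f : (Fin n → ℝ) → CD r) (u : CD r → (Fin n → ℝ) → CD r → CD r)
    (p ζ : CD r) (t : Fin n → ℝ) : CD r := mul (f t) (exp (-u p t ζ))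

/-- The image `F^n(f,u;p;ζ) = ∫_{ℝⁿ} f(t) exp(-u(p,t;ζ)) dt`. -/
def image {r n : ℕ} (f : (Fin n → ℝ) → CD r) (u : CD r → (Fin n → ℝ) → CD r → CD r)
    (p ζ : CD r) : CD r := ∫ t : Fin n → ℝ, integrand f u p ζ t

/-- The strip `a₁ < Re p < a_{-1}`. -/
def strip (r : ℕ) (a₁ am₁ : ℝ) : Set (CD r) := {p | a₁ < coord p 0 ∧ coord p 0 < am₁}

end CD

end

/-!
For both coordinate systems `exp (-u(p,t;ζ)) = Ψ(x)`, where the arguments `x_j = ℓ_j(t) p_j + ζ_j`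
are affine in `p` and in `ζ`, the factors `ℓ_j` are sums of some of the `t_i`, and `Ψ` is a fixed
function on `A_r` (`CD.IsPhase`).  Since a purely imaginary unit `e` satisfies `e e = -1`, the span
of `1` and `e` is a copy of `ℂ`, and `exp (a + b e) = e^a (cos b + e sin b)`
(`CD.exp_add_smul`).  Hence `Ψ` is `e^{-x_0}` times a combination of `cos |X|` and
`X sin |X| / |X|` in Cartesian coordinates, and of products of sines and cosines of single
coordinates in spherical ones.

The components of `Ψ` extend along every real line to entire functions of one complex variable of
exponential type, with constants that do not depend on the line (`CD.ExpType`).  Cauchy's estimate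
on a disc of radius `2` makes the Taylor terms of `Ψ(x + y)` in `y` smaller than
`C e^{-x_0} e^{c |y|} 2^{-k}` (`CD.ExpType.taylor`).  A small increment `h` of `p` or `ζ` gives
`|y| ≤ (1 + ∑ |t_i|) |h|`, so `e^{c |y|}` is at most `e^{ε (1 + ∑ |t_i|)}`, which the growth
condition on `f` absorbs inside the strip (`CD.IsOriginal.exists_integrable`).
So the integral converges absolutely, and the Taylor series of the integrand may be integrated term
by term (`CD.holomorphicAt_integral`).

It remains to see that the integrated terms are polynomials over `A_r`.  A finite-dimensional space
of functions is stable under integration (`CD.integral_mem_of_finiteDimensional`).  For `r ≥ 2`,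
every homogeneous real polynomial map is a sum of words (`CD.realHomPoly_le_homPoly`), because the
real coordinates are: with two different imaginary units `i_1`, `i_2` the operators
`z ↦ i_j (z i_j)` generate the projection onto the real line (`CD.re_mem_homPoly`).
For `r = 1` this fails; there `n = 1`, both coordinate systems reduce to `u = p t + ζ`,
and the complex exponential series gives terms of the form `c h^k`.
-/

noncomputable section

namespace CD

/-! ### The Cayley-Dickson algebras -/

section Coordinates

variable {r : ℕ}

@[simp] lemma lo_join (x y : Fin (2 ^ r) → ℝ) : lo (join x y) = x := by
  ext j
  simp [lo, join]

@[simp] lemma hi_join (x y : Fin (2 ^ r) → ℝ) : hi (join x y) = y := by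
  ext j
  simp [hi, join]

@[simp] lemma join_lo_hi (x : Fin (2 ^ (r + 1)) → ℝ) : join (lo x) (hi x) = x := by
  ext j
  by_cases h : j.1 < 2 ^ r
  · simp [lo, join, h]
  · simp only [join, h, dite_false, hi]
    congr 1
    ext
    simp only
    omega

lemma eq_of_lo_hi {x y : Fin (2 ^ (r + 1)) → ℝ} (h₁ : lo x = lo y) (h₂ : hi x = hi y) : x = y := by
  rw [← join_lo_hi x, ← join_lo_hi y, h₁, h₂]

@[simp] lemma lo_add (x y : Fin (2 ^ (r + 1)) → ℝ) : lo (x + y) = lo x + lo y := rfl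
@[simp] lemma hi_add (x y : Fin (2 ^ (r + 1)) → ℝ) : hi (x + y) = hi x + hi y := rfl
@[simp] lemma lo_neg (x : Fin (2 ^ (r + 1)) → ℝ) : lo (-x) = -lo x := rfl
@[simp] lemma hi_neg (x : Fin (2 ^ (r + 1)) → ℝ) : hi (-x) = -hi x := rfl
@[simp] lemma lo_smul (c : ℝ) (x : Fin (2 ^ (r + 1)) → ℝ) : lo (c • x) = c • lo x := rfl
@[simp] lemma hi_smul (c : ℝ) (x : Fin (2 ^ (r + 1)) → ℝ) : hi (c • x) = c • hi x := rfl

lemma conjAux_add (x y : Fin (2 ^ r) → ℝ) : conjAux r (x + y) = conjAux r x + conjAux r y := by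
  induction r with
  | zero => rfl
  | succ r ih => exact eq_of_lo_hi (by simp [conjAux, ih]) (by simp [conjAux, add_comm])

lemma conjAux_smul (c : ℝ) (x : Fin (2 ^ r) → ℝ) : conjAux r (c • x) = c • conjAux r x := by
  induction r with
  | zero => rfl
  | succ r ih => exact eq_of_lo_hi (by simp [conjAux, ih]) (by simp [conjAux])

lemma conjAux_conjAux (x : Fin (2 ^ r) → ℝ) : conjAux r (conjAux r x) = x := by
  induction r with
  | zero => rfl
  | succ r ih => exact eq_of_lo_hi (by simp [conjAux, ih]) (by simp [conjAux])

lemma lo_mulAux (x y : Fin (2 ^ (r + 1)) → ℝ) : lo (mulAux (r + 1) x y) =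
    mulAux r (lo x) (lo y) - mulAux r (conjAux r (hi y)) (hi x) := by
  simp [mulAux]

lemma hi_mulAux (x y : Fin (2 ^ (r + 1)) → ℝ) : hi (mulAux (r + 1) x y) =
    mulAux r (hi y) (lo x) + mulAux r (hi x) (conjAux r (lo y)) := by
  simp [mulAux]

lemma mulAux_bilinear :
    (∀ x y z : Fin (2 ^ r) → ℝ, mulAux r (x + y) z = mulAux r x z + mulAux r y z) ∧
    (∀ x y z : Fin (2 ^ r) → ℝ, mulAux r x (y + z) = mulAux r x y + mulAux r x z) ∧
    (∀ (c : ℝ) (x y : Fin (2 ^ r) → ℝ), mulAux r (c • x) y = c • mulAux r x y) ∧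
    (∀ (c : ℝ) (x y : Fin (2 ^ r) → ℝ), mulAux r x (c • y) = c • mulAux r x y) := by
  induction r with
  | zero =>
    refine ⟨?_, ?_, ?_, ?_⟩ <;> intros <;> ext <;> simp [mulAux] <;> ring
  | succ r ih =>
    obtain ⟨h₁, h₂, h₃, h₄⟩ := ih
    refine ⟨fun x y z => ?_, fun x y z => ?_, fun c x y => ?_, fun c x y => ?_⟩ <;>
      refine eq_of_lo_hi ?_ ?_ <;>
      simp only [lo_mulAux, hi_mulAux, lo_add, hi_add, lo_smul, hi_smul, conjAux_add,
        conjAux_smul, h₁, h₂, h₃, h₄, smul_sub, smul_add] <;> abel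

/-- The product of the Cayley-Dickson algebra as a bilinear map in coordinates. -/
def mulAuxₗ (r : ℕ) : (Fin (2 ^ r) → ℝ) →ₗ[ℝ] (Fin (2 ^ r) → ℝ) →ₗ[ℝ] (Fin (2 ^ r) → ℝ) :=
  LinearMap.mk₂ ℝ (mulAux r) mulAux_bilinear.1 mulAux_bilinear.2.2.1 mulAux_bilinear.2.1
    mulAux_bilinear.2.2.2

lemma mulAux_zero (x : Fin (2 ^ r) → ℝ) : mulAux r x 0 = 0 := map_zero (mulAuxₗ r x)

lemma zero_mulAux (x : Fin (2 ^ r) → ℝ) : mulAux r 0 x = 0 := (mulAuxₗ r).map_zero₂ x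

lemma mulAux_neg (x y : Fin (2 ^ r) → ℝ) : mulAux r x (-y) = -mulAux r x y :=
  map_neg (mulAuxₗ r x) y

lemma neg_mulAux (x y : Fin (2 ^ r) → ℝ) : mulAux r (-x) y = -mulAux r x y :=
  (mulAuxₗ r).map_neg₂ x y

lemma conjAux_zero : conjAux r 0 = 0 := by simpa using conjAux_smul 0 (0 : Fin (2 ^ r) → ℝ)

/-- The coordinates of the generator `i_j`. -/
def genAux (r j : ℕ) : Fin (2 ^ r) → ℝ := fun k => if k.1 = j then 1 else 0

lemma lo_genAux (j : ℕ) : lo (genAux (r + 1) j) = genAux r j := rfl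

lemma hi_genAux {j : ℕ} (hj : j < 2 ^ r) : hi (genAux (r + 1) j) = 0 := by
  ext k
  have : k.1 + 2 ^ r ≠ j := by omega
  simp [hi, genAux, this]

lemma conjAux_apply (x : Fin (2 ^ r) → ℝ) (j : Fin (2 ^ r)) :
    conjAux r x j = if j.1 = 0 then x j else -x j := by
  induction r with
  | zero => simp [conjAux]
  | succ r ih =>
    have h2 : 0 < 2 ^ r := by positivity
    by_cases h : j.1 < 2 ^ r
    · simp [conjAux, join, h, ih, lo]
    · have h0 : j.1 ≠ 0 := by omega
      have : j.1 - 2 ^ r + 2 ^ r = j.1 := by omega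
      simp [conjAux, join, h, h0, hi, this]

lemma conjAux_genAux_zero : conjAux r (genAux r 0) = genAux r 0 := by
  ext j
  rw [conjAux_apply]
  by_cases h : j.1 = 0 <;> simp [genAux, h]

lemma conjAux_genAux {j : ℕ} (hj : j ≠ 0) : conjAux r (genAux r j) = -genAux r j := by
  ext k
  rw [conjAux_apply]
  by_cases h : k.1 = 0
  · simp [genAux, h, hj.symm]
  · simp [h]

lemma mulAux_one_and_one_mulAux :
    (∀ x : Fin (2 ^ r) → ℝ, mulAux r x (genAux r 0) = x) ∧
      ∀ x : Fin (2 ^ r) → ℝ, mulAux r (genAux r 0) x = x := by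
  induction r with
  | zero =>
    constructor <;> intro x <;> ext j <;> simp [mulAux, genAux]
  | succ r ih =>
    have h2 : 0 < 2 ^ r := by positivity
    constructor <;> intro x <;> refine eq_of_lo_hi ?_ ?_ <;>
      simp [lo_mulAux, hi_mulAux, lo_genAux, hi_genAux h2, ih.1, ih.2, conjAux_zero, zero_mulAux,
        conjAux_genAux_zero, mulAux_zero]

lemma sum_eq_lo_add_hi (x : Fin (2 ^ (r + 1)) → ℝ) : ∑ j, x j = ∑ j, lo x j + ∑ j, hi x j := by
  have e : 2 ^ r + 2 ^ r = 2 ^ (r + 1) := by ring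
  rw [← Equiv.sum_comp (finCongr e), Fin.sum_univ_add]
  congr 1
  refine Finset.sum_congr rfl fun j _ => ?_
  simp only [hi]
  congr 1
  ext
  simp

/-- `x^* x = |x|^2`. -/
lemma mulAux_conjAux_self (x : Fin (2 ^ r) → ℝ) :
    mulAux r (conjAux r x) x = (∑ j, x j ^ 2) • genAux r 0 := by
  induction r with
  | zero =>
    ext j
    simp [mulAux, conjAux, genAux, pow_two, Subsingleton.elim (α := Fin 1) _ j]
  | succ r ih =>
    have h2 : 0 < 2 ^ r := by positivity
    refine eq_of_lo_hi ?_ ?_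
    · have := sum_eq_lo_add_hi (fun j => x j ^ 2)
      rw [this]
      have e₁ : lo (fun j => x j ^ 2) = fun j => lo x j ^ 2 := rfl
      have e₂ : hi (fun j => x j ^ 2) = fun j => hi x j ^ 2 := rfl
      simp [lo_mulAux, conjAux, ih, lo_genAux, mulAux_neg, add_smul, e₁, e₂]
    · simp [hi_mulAux, conjAux, hi_genAux h2, neg_mulAux]

/-- The real part of a product is the scalar product with the conjugate. -/
lemma mulAux_apply_zero (x y : Fin (2 ^ r) → ℝ) :
    mulAux r x y ⟨0, by positivity⟩ = ∑ j, conjAux r x j * y j := by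
  induction r with
  | zero => simp [mulAux, conjAux]
  | succ r ih =>
    have h := congrFun (lo_mulAux x y) ⟨0, by positivity⟩
    rw [sum_eq_lo_add_hi]
    have e₁ : lo (fun j => conjAux (r + 1) x j * y j) = fun j => conjAux r (lo x) j * lo y j := by
      ext j
      change lo (conjAux (r + 1) x) j * lo y j = _
      simp [conjAux]
    have e₂ : hi (fun j => conjAux (r + 1) x j * y j) = fun j => -(hi y j * hi x j) := by
      ext j
      change hi (conjAux (r + 1) x) j * hi y j = _
      simp [conjAux, mul_comm]
    rw [e₁, e₂]
    simp only [Pi.sub_apply, ih, conjAux_conjAux] at h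
    rw [Finset.sum_neg_distrib, ← sub_eq_add_neg, ← h]
    rfl

/-- Multiplication by one of the units `i_1`, `i_2` in `A_r`, `r ≥ 2`:
`(x i_j) i_j = -x`, and `x ↦ i_j (x i_j)` changes the sign of the components along `1` and `i_j`. -/
lemma mulAux_genAux_genAux {j : ℕ} (hj : j = 1 ∨ j = 2) (hr : 2 ≤ r) :
    (∀ x : Fin (2 ^ r) → ℝ, mulAux r (mulAux r x (genAux r j)) (genAux r j) = -x) ∧
      ∀ x : Fin (2 ^ r) → ℝ, mulAux r (genAux r j) (mulAux r x (genAux r j)) =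
        fun k => if k.1 = 0 ∨ k.1 = j then -x k else x k := by
  have hj0 : j ≠ 0 := by omega
  induction r, hr using Nat.le_induction with
  | base =>
    constructor <;> intro x <;> ext k <;> change Fin 4 at k <;> rcases hj with rfl | rfl <;>
      fin_cases k <;>
      simp [mulAux, conjAux, join, lo, hi, genAux]
  | succ r hr ih =>
    -- `i_1` and `i_2` lie in the first summand `A_r` of `A_{r+1} = A_r + A_r l`.
    have h4 : 2 ^ 2 ≤ 2 ^ r := Nat.pow_le_pow_right (by norm_num) hr
    have hj2 : j < 2 ^ r := by omega
    constructor <;> intro x <;> refine eq_of_lo_hi ?_ ?_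
    · simp [lo_mulAux, hi_mulAux, lo_genAux, hi_genAux hj2, conjAux_zero, zero_mulAux, ih.1]
    · simp [hi_mulAux, lo_genAux, hi_genAux hj2, zero_mulAux, ih.1, conjAux_genAux hj0,
        mulAux_neg, neg_mulAux]
    · simp only [lo_mulAux, hi_mulAux, lo_genAux, hi_genAux hj2, conjAux_zero, zero_mulAux,
        mulAux_zero, sub_zero, ih.2]
      rfl
    · simp only [lo_mulAux, hi_mulAux, lo_genAux, hi_genAux hj2, conjAux_zero, zero_mulAux,
        sub_zero, zero_add, add_zero, conjAux_genAux hj0, mulAux_neg, neg_mulAux, ih.1, neg_neg]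
      ext k
      have h₁ : k.1 + 2 ^ r ≠ j := by omega
      simp [hi, h₁]

end Coordinates

section Algebra

variable {r : ℕ}

/-- The product of `A_r` as a bilinear map. -/
def mulₗ (r : ℕ) : CD r →ₗ[ℝ] CD r →ₗ[ℝ] CD r :=
  LinearMap.mk₂ ℝ mul
    (fun x y z => by simp only [mul, WithLp.ofLp_add, mulAux_bilinear.1, WithLp.toLp_add])
    (fun c x y => by simp only [mul, WithLp.ofLp_smul, mulAux_bilinear.2.2.1, WithLp.toLp_smul])
    (fun x y z => by simp only [mul, WithLp.ofLp_add, mulAux_bilinear.2.1, WithLp.toLp_add])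
    (fun c x y => by simp only [mul, WithLp.ofLp_smul, mulAux_bilinear.2.2.2, WithLp.toLp_smul])

lemma add_mul (x y z : CD r) : mul (x + y) z = mul x z + mul y z := (mulₗ r).map_add₂ x y z
lemma mul_add (x y z : CD r) : mul x (y + z) = mul x y + mul x z := map_add (mulₗ r x) y z
lemma smul_mul (c : ℝ) (x y : CD r) : mul (c • x) y = c • mul x y := (mulₗ r).map_smul₂ c x y
lemma mul_smul (c : ℝ) (x y : CD r) : mul x (c • y) = c • mul x y := map_smul (mulₗ r x) c y
lemma mul_sum {ι : Type*} (s : Finset ι) (x : CD r) (y : ι → CD r) :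
    mul x (∑ i ∈ s, y i) = ∑ i ∈ s, mul x (y i) := map_sum (mulₗ r x) y s

lemma gen_eq (j : ℕ) : gen r j = WithLp.toLp 2 (genAux r j) := rfl

@[simp] lemma one_mul (x : CD r) : mul (gen r 0) x = x := by
  simp [mul, gen_eq, mulAux_one_and_one_mulAux.2]

@[simp] lemma mul_one (x : CD r) : mul x (gen r 0) = x := by
  simp [mul, gen_eq, mulAux_one_and_one_mulAux.1]

lemma gen_val (j : Fin (2 ^ r)) : gen r j.1 = EuclideanSpace.single j (1 : ℝ) := by
  ext k
  simp [gen, Fin.ext_iff]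

lemma sum_smul_gen (x : CD r) : ∑ j : Fin (2 ^ r), x j • gen r j.1 = x := by
  simpa [gen_val] using (EuclideanSpace.basisFun (Fin (2 ^ r)) ℝ).sum_repr x

/-- A purely imaginary number of modulus one is a square root of `-1`. -/
lemma mul_self_of_imaginary {e : CD r} (h0 : e ⟨0, by positivity⟩ = 0) (h1 : ‖e‖ = 1) :
    mul e e = -gen r 0 := by
  have hc : conjAux r e.ofLp = -e.ofLp := by
    ext j
    rw [conjAux_apply]
    by_cases h : j.1 = 0
    · have : j = ⟨0, by positivity⟩ := Fin.ext h
      rw [if_pos h, this, Pi.neg_apply, h0, neg_zero]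
    · simp [h]
  have h2 : ∑ j, e j ^ 2 = 1 := by
    rw [EuclideanSpace.norm_eq, Real.sqrt_eq_one] at h1
    simpa using h1
  have h := mulAux_conjAux_self e.ofLp
  rw [hc, neg_mulAux, h2, one_smul, neg_eq_iff_eq_neg] at h
  simp only [mul, h]
  rfl

/-- Every purely imaginary number is a real multiple of a square root of `-1`. -/
lemma exists_imaginary_unit (hr : 1 ≤ r) {m : CD r} (h0 : m ⟨0, by positivity⟩ = 0) :
    ∃ e : CD r, mul e e = -gen r 0 ∧ m = ‖m‖ • e := by
  by_cases hm : m = 0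
  · -- Any unit will do for `m = 0`; `i_1` exists because `r ≥ 1`.
    have h2 : 2 ^ 1 ≤ 2 ^ r := Nat.pow_le_pow_right (by norm_num) hr
    refine ⟨gen r 1, mul_self_of_imaginary ?_ ?_, by simp [hm]⟩
    · simp [gen]
    · rw [show gen r 1 = EuclideanSpace.single ⟨1, by omega⟩ (1 : ℝ) from gen_val ⟨1, by omega⟩]
      simp
  · have hm' : ‖m‖ ≠ 0 := by simpa using hm
    refine ⟨‖m‖⁻¹ • m, mul_self_of_imaginary (by rw [PiLp.smul_apply, h0, smul_zero]) ?_, ?_⟩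
    · simp [norm_smul, hm']
    · simp [smul_smul, hm']

/-- A square root `e` of `-1` spans with `1` a copy of the complex numbers, in which `exp` is the
complex exponential. -/
lemma exp_add_smul {e : CD r} (he : mul e e = -gen r 0) (a b : ℝ) :
    exp (a • gen r 0 + b • e) =
      (Real.exp a * Real.cos b) • gen r 0 + (Real.exp a * Real.sin b) • e := by
  let ι : ℂ →L[ℝ] CD r := Complex.reCLM.smulRight (gen r 0) + Complex.imCLM.smulRight e
  have hι (w : ℂ) : ι w = w.re • gen r 0 + w.im • e := by simp [ι]
  have hmul (w z : ℂ) : mul (ι w) (ι z) = ι (w * z) := by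
    simp only [hι, add_mul, mul_add, smul_mul, mul_smul, one_mul, mul_one, he, Complex.mul_re,
      Complex.mul_im]
    module
  have hpow (w : ℂ) (k : ℕ) : npow (ι w) k = ι (w ^ k) := by
    induction k with
    | zero => simp [npow, hι]
    | succ k ih => rw [npow, ih, hmul, pow_succ]
  have hexp (w : ℂ) : exp (ι w) = ι (Complex.exp w) := by
    have h : HasSum (fun k : ℕ => ((k.factorial : ℝ)⁻¹) • w ^ k) (Complex.exp w) := by
      rw [Complex.exp_eq_exp_ℂ]
      exact NormedSpace.exp_series_hasSum_exp' (𝕂 := ℝ) w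
    have h' := ι.hasSum h
    simp only [map_smul] at h'
    simp only [exp, hpow]
    exact h'.tsum_eq
  have := hexp ⟨a, b⟩
  rw [hι, hι] at this
  rw [this, Complex.exp_re, Complex.exp_im]

end Algebra

/-! ### Words and homogeneous polynomials -/

section HomPoly

variable {r : ℕ}

lemma Word.eval_mem_homPoly (w : Word r) : w.eval ∈ homPoly r w.degree :=
  Submodule.subset_span ⟨w, rfl, rfl⟩

lemma const_mem_homPoly (a : CD r) : (fun _ => a) ∈ homPoly r 0 :=
  (Word.const a).eval_mem_homPoly

lemma id_mem_homPoly : (fun h : CD r => h) ∈ homPoly r 1 :=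
  (Word.var : Word r).eval_mem_homPoly

lemma mul_mem_homPoly {k l : ℕ} {P Q : CD r → CD r} (hP : P ∈ homPoly r k)
    (hQ : Q ∈ homPoly r l) : (fun h => mul (P h) (Q h)) ∈ homPoly r (k + l) := by
  induction hP using Submodule.span_induction with
  | mem P hP =>
    obtain ⟨w, rfl, rfl⟩ := hP
    induction hQ using Submodule.span_induction with
    | mem Q hQ =>
      obtain ⟨w', rfl, rfl⟩ := hQ
      exact (Word.mul w w').eval_mem_homPoly
    | zero => simpa only [Pi.zero_apply, map_zero (mulₗ r _), show ∀ x : CD r, mul x 0 = 0 from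
        fun x => map_zero (mulₗ r x)] using! (homPoly r _).zero_mem
    | add Q Q' _ _ h h' => simpa only [Pi.add_apply, mul_add] using! (homPoly r _).add_mem h h'
    | smul c Q _ h => simpa only [Pi.smul_apply, mul_smul] using! (homPoly r _).smul_mem c h
  | zero => simpa only [Pi.zero_apply, show ∀ x : CD r, mul 0 x = 0 from
        fun x => (mulₗ r).map_zero₂ x] using! (homPoly r _).zero_mem
  | add Q Q' _ _ h h' => simpa only [Pi.add_apply, add_mul] using! (homPoly r _).add_mem h h'
  | smul c Q _ h => simpa only [Pi.smul_apply, smul_mul] using! (homPoly r _).smul_mem c h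

lemma npow_mem_homPoly (k : ℕ) : (fun h : CD r => npow h k) ∈ homPoly r k := by
  induction k with
  | zero => exact const_mem_homPoly _
  | succ k ih => exact mul_mem_homPoly ih id_mem_homPoly

/-- For `r ≥ 2` the real part is a polynomial over `A_r`: with `T_j z = i_j (z i_j)`, the operators
`(1 - T_j) / 2` for `j = 1, 2` are the coordinate projections onto the spans of `1, i_j`, and their
product is the projection onto the real line.  In `A_1 = ℂ` there is only one imaginary
unit, and the real part is not a polynomial. -/
lemma re_mem_homPoly (hr : 2 ≤ r) {k : ℕ} {P : CD r → CD r} (hP : P ∈ homPoly r k) :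
    (fun h => P h ⟨0, by positivity⟩ • gen r 0) ∈ homPoly r k := by
  have step (j : ℕ) {Q : CD r → CD r} (hQ : Q ∈ homPoly r k) :
      (fun h => (2⁻¹ : ℝ) • (Q h - mul (gen r j) (mul (Q h) (gen r j)))) ∈ homPoly r k := by
    refine Submodule.smul_mem _ _ (Submodule.sub_mem _ hQ ?_)
    have := mul_mem_homPoly (const_mem_homPoly (gen r j)) (mul_mem_homPoly hQ
      (const_mem_homPoly (gen r j)))
    simpa using this
  have hproj (j : ℕ) (hj : j = 1 ∨ j = 2) (z : CD r) (l : Fin (2 ^ r)) :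
      ((2⁻¹ : ℝ) • (z - mul (gen r j) (mul z (gen r j)))) l =
        if l.1 = 0 ∨ l.1 = j then z l else 0 := by
    have h : (mul (gen r j) (mul z (gen r j))) l = if l.1 = 0 ∨ l.1 = j then -z l else z l := by
      simp only [mul, gen_eq, (mulAux_genAux_genAux hj hr).2]
    rw [PiLp.smul_apply, PiLp.sub_apply, h]
    split_ifs
    · simp only [smul_eq_mul]
      ring
    · simp
  have h := step 2 (step 1 hP)
  convert! h using 1
  ext x l
  rw [hproj 2 (Or.inr rfl), hproj 1 (Or.inl rfl)]
  by_cases hl : l.1 = 0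
  · have : l = ⟨0, by positivity⟩ := Fin.ext hl
    subst this
    simp [gen]
  · have : ¬ (l.1 = 2 ∧ l.1 = 1) := by omega
    simp only [gen, PiLp.smul_apply, hl, false_or, if_false, smul_zero]
    split_ifs <;> first | rfl | omega

/-- For `r ≥ 2` the real coordinates are polynomials over `A_r`, because
`z_j = Re (i_j^* z)`. -/
lemma apply_smul_one_mem_homPoly (hr : 2 ≤ r) (j : Fin (2 ^ r)) :
    (fun h : CD r => h j • gen r 0) ∈ homPoly r 1 := by
  have := re_mem_homPoly hr (mul_mem_homPoly
    (const_mem_homPoly (WithLp.toLp 2 (conjAux r (genAux r j)) : CD r)) id_mem_homPoly)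
  convert! this using 3 with h
  simp only [mul, mulAux_apply_zero, conjAux_conjAux]
  rw [Finset.sum_eq_single j] <;> simp +contextual [genAux, Fin.ext_iff]

lemma prod_smul_mem_homPoly (hr : 2 ≤ r) {k : ℕ} (i : Fin k → Fin (2 ^ r)) (c : CD r) :
    (fun h : CD r => (∏ j, h (i j)) • c) ∈ homPoly r k := by
  induction k with
  | zero => simpa using const_mem_homPoly c
  | succ k ih =>
    have := mul_mem_homPoly (apply_smul_one_mem_homPoly hr (i 0)) (ih fun j => i j.succ)
    rw [add_comm] at this
    convert! this using 2 with h
    rw [Fin.prod_univ_succ, smul_mul, one_mul, SemigroupAction.mul_smul]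

/-- The homogeneous real polynomial maps of degree `k` on `A_r`. -/
def realHomPoly (r k : ℕ) : Submodule ℝ (CD r → CD r) :=
  LinearMap.range (({ toFun := fun M h => M fun _ => h
                      map_add' := fun _ _ => rfl
                      map_smul' := fun _ _ => rfl } :
    MultilinearMap ℝ (fun _ : Fin k => CD r) (CD r) →ₗ[ℝ] (CD r → CD r)))

instance (r k : ℕ) : FiniteDimensional ℝ (realHomPoly r k) := by
  unfold realHomPoly
  infer_instance

lemma diag_mem_realHomPoly {k : ℕ} (M : MultilinearMap ℝ (fun _ : Fin k => CD r) (CD r)) :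
    (fun h => M fun _ => h) ∈ realHomPoly r k := ⟨M, rfl⟩

/-- For `r ≥ 2` every real homogeneous polynomial map is a homogeneous polynomial over `A_r`. -/
lemma realHomPoly_le_homPoly (hr : 2 ≤ r) (k : ℕ) : realHomPoly r k ≤ homPoly r k := by
  rintro _ ⟨M, rfl⟩
  have h (x : CD r) : M (fun _ => x) =
      ∑ i : Fin k → Fin (2 ^ r), (∏ j, x (i j)) • M fun j => gen r (i j).1 := by
    conv_lhs => rw [← sum_smul_gen x]
    rw [M.map_sum]
    simp only [M.map_smul_univ]
  have : (fun x => M fun _ => x) =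
      ∑ i : Fin k → Fin (2 ^ r), fun x => (∏ j, x (i j)) • M fun j => gen r (i j).1 := by
    ext1 x
    rw [h, Finset.sum_apply]
  change (fun x => M fun _ => x) ∈ _
  rw [this]
  exact Submodule.sum_mem _ fun i _ => prod_smul_mem_homPoly hr i _

end HomPoly

/-! ### Integrals with values in a finite-dimensional space of functions -/

/-- A family of functions from a finite-dimensional space, integrable at every point, has its
integral in that space: the evaluations span the dual space, so the coordinates with respect to a
basis are integrable. -/
lemma integral_mem_of_finiteDimensional {X ι Ω : Type*} [Fintype ι] [MeasurableSpace Ω]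
    {μ : Measure Ω} (W : Submodule ℝ (X → EuclideanSpace ℝ ι)) [FiniteDimensional ℝ W]
    (q : Ω → X → EuclideanSpace ℝ ι) (hq : ∀ t, q t ∈ W)
    (hint : ∀ x, Integrable (fun t => q t x) μ) : (fun x => ∫ t, q t x ∂μ) ∈ W := by
  let ev (a : X × ι) : Module.Dual ℝ W :=
    (LinearMap.proj a.2 ∘ₗ (WithLp.linearEquiv 2 ℝ (ι → ℝ)).toLinearMap ∘ₗ
      LinearMap.proj a.1) ∘ₗ W.subtype
  have hspan : Submodule.span ℝ (Set.range ev) = ⊤ := by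
    rw [← Subspace.dualCoannihilator_dualAnnihilator_eq
      (W := Submodule.span ℝ (Set.range ev)), eq_top_iff]
    rintro φ -
    rw [Submodule.mem_dualAnnihilator]
    intro w hw
    have : w = 0 := by
      ext x i
      exact (Submodule.mem_dualCoannihilator w).1 hw _ (Submodule.subset_span ⟨(x, i), rfl⟩)
    rw [this, map_zero]
  have hφ (φ : Module.Dual ℝ W) : Integrable (fun t => φ ⟨q t, hq t⟩) μ := by
    have : φ ∈ Submodule.span ℝ (Set.range ev) := hspan ▸ Submodule.mem_top
    induction this using Submodule.span_induction with
    | mem φ h =>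
      obtain ⟨⟨x, i⟩, rfl⟩ := h
      exact (EuclideanSpace.proj (𝕜 := ℝ) i).integrable_comp (hint x)
    | zero => simp
    | add φ ψ _ _ h h' => exact h.add h'
    | smul c φ _ h => exact h.smul c
  let b := Module.finBasis ℝ W
  have hrepr (t : Ω) (x : X) : q t x = ∑ i, b.coord i ⟨q t, hq t⟩ • (b i : X → _) x := by
    have h := congrFun (congrArg W.subtype (b.sum_repr ⟨q t, hq t⟩)) x
    rw [map_sum] at h
    simp only [map_smul, Finset.sum_apply, Pi.smul_apply] at h
    exact h.symm
  have : (fun x => ∫ t, q t x ∂μ) =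
      ∑ i, (∫ t, b.coord i ⟨q t, hq t⟩ ∂μ) • (b i : X → EuclideanSpace ℝ ι) := by
    ext1 x
    simp only [hrepr, Finset.sum_apply, Pi.smul_apply]
    rw [integral_finsetSum _ fun i _ => (hφ _).smul_const _]
    simp only [integral_smul_const]
  rw [this]
  exact Submodule.sum_mem _ fun i _ => W.smul_mem _ (b i).2

/-! ### Entire functions of exponential type on a real normed space -/

section ExpType

variable {E : Type*} [NormedAddCommGroup E] [NormedSpace ℝ E]

/-- A smooth function `ψ` on a real normed space whose restriction to every line extends to an
entire function `g` of one complex variable, with the exponential bound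
`|g z| ≤ C W(x) e^{c |z| ‖y‖}` on the complexification of the line `x + ℝ y`, where `C`, `c`
depend neither on `x` nor on `y`. -/
def ExpType (W ψ : E → ℝ) : Prop :=
  ContDiff ℝ (⊤ : ℕ∞) ψ ∧ ∃ C ≥ 0, ∃ c ≥ 0, ∀ x y : E, ∃ g : ℂ → ℂ, Differentiable ℂ g ∧
    (∀ τ : ℝ, g τ = ψ (x + τ • y)) ∧ ∀ z, ‖g z‖ ≤ C * W x * Real.exp (c * (‖z‖ * ‖y‖))

lemma ExpType.mul {W₁ W₂ ψ₁ ψ₂ : E → ℝ} (h₁ : ExpType W₁ ψ₁) (h₂ : ExpType W₂ ψ₂) :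
    ExpType (fun x => W₁ x * W₂ x) fun x => ψ₁ x * ψ₂ x := by
  obtain ⟨hd₁, C₁, hC₁, c₁, hc₁, h₁⟩ := h₁
  obtain ⟨hd₂, C₂, hC₂, c₂, hc₂, h₂⟩ := h₂
  refine ⟨hd₁.mul hd₂, C₁ * C₂, by positivity, c₁ + c₂, by positivity, fun x y => ?_⟩
  obtain ⟨g₁, hg₁, he₁, hb₁⟩ := h₁ x y
  obtain ⟨g₂, hg₂, he₂, hb₂⟩ := h₂ x y
  refine ⟨fun z => g₁ z * g₂ z, hg₁.mul hg₂, fun τ => by simp [he₁, he₂], fun z => ?_⟩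
  rw [norm_mul]
  calc _ ≤ _ := mul_le_mul (hb₁ z) (hb₂ z) (norm_nonneg _) ((norm_nonneg _).trans (hb₁ z))
    _ = _ := by rw [_root_.add_mul, Real.exp_add]; ring

lemma ExpType.add {W ψ₁ ψ₂ : E → ℝ} (h₁ : ExpType W ψ₁) (h₂ : ExpType W ψ₂)
    (hW : ∀ x, 0 ≤ W x) : ExpType W fun x => ψ₁ x + ψ₂ x := by
  obtain ⟨hd₁, C₁, hC₁, c₁, hc₁, h₁⟩ := h₁
  obtain ⟨hd₂, C₂, hC₂, c₂, hc₂, h₂⟩ := h₂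
  refine ⟨hd₁.add hd₂, C₁ + C₂, by positivity, c₁ + c₂, by positivity, fun x y => ?_⟩
  obtain ⟨g₁, hg₁, he₁, hb₁⟩ := h₁ x y
  obtain ⟨g₂, hg₂, he₂, hb₂⟩ := h₂ x y
  refine ⟨fun z => g₁ z + g₂ z, hg₁.add hg₂, fun τ => by simp [he₁, he₂], fun z => ?_⟩
  have := hW x
  calc _ ≤ ‖g₁ z‖ + ‖g₂ z‖ := norm_add_le _ _
    _ ≤ C₁ * W x * Real.exp ((c₁ + c₂) * (‖z‖ * ‖y‖)) +
        C₂ * W x * Real.exp ((c₁ + c₂) * (‖z‖ * ‖y‖)) := by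
      refine add_le_add ((hb₁ z).trans ?_) ((hb₂ z).trans ?_) <;> gcongr <;> linarith
    _ = _ := by ring

lemma ExpType.const (a : ℝ) : ExpType (fun _ : E => 1) fun _ => a :=
  ⟨contDiff_const, |a|, abs_nonneg a, 0, le_rfl, fun x y => ⟨fun _ => a,
    differentiable_const _, fun _ => rfl, fun z => by simp⟩⟩

lemma ExpType.const_mul {W ψ : E → ℝ} (a : ℝ) (h : ExpType W ψ) :
    ExpType W fun x => a * ψ x := by
  simpa using (ExpType.const a).mul h

lemma ExpType.mul_one_weight {ψ₁ ψ₂ : E → ℝ} (h₁ : ExpType (fun _ => 1) ψ₁)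
    (h₂ : ExpType (fun _ => 1) ψ₂) : ExpType (fun _ => 1) fun x => ψ₁ x * ψ₂ x := by
  simpa using h₁.mul h₂

lemma ExpType.prod {ι : Type*} (s : Finset ι) {ψ : ι → E → ℝ}
    (h : ∀ i ∈ s, ExpType (fun _ => 1) (ψ i)) : ExpType (fun _ => 1) fun x => ∏ i ∈ s, ψ i x := by
  classical
  induction s using Finset.induction_on with
  | empty => simpa using ExpType.const 1
  | insert a s ha ih =>
    have := (h a (by simp)).mul_one_weight (ih fun i hi => h i (by simp [hi]))
    simpa [Finset.prod_insert ha] using this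

lemma ExpType.sum {ι : Type*} (s : Finset ι) {ψ : ι → E → ℝ}
    (h : ∀ i ∈ s, ExpType (fun _ => 1) (ψ i)) : ExpType (fun _ => 1) fun x => ∑ i ∈ s, ψ i x := by
  classical
  induction s using Finset.induction_on with
  | empty => simpa using ExpType.const 0
  | insert a s ha ih =>
    have := (h a (by simp)).add (ih fun i hi => h i (by simp [hi])) fun _ => zero_le_one
    simpa [Finset.sum_insert ha] using this

lemma norm_cos_le_exp_abs_im (z : ℂ) : ‖Complex.cos z‖ ≤ Real.exp |z.im| := by
  have h1 : ‖Complex.exp (z * Complex.I)‖ ≤ Real.exp |z.im| := by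
    rw [Complex.norm_exp]
    exact Real.exp_le_exp.2 (by simpa using neg_le_abs z.im)
  have h2 : ‖Complex.exp (-z * Complex.I)‖ ≤ Real.exp |z.im| := by
    rw [Complex.norm_exp]
    exact Real.exp_le_exp.2 (by simpa using le_abs_self z.im)
  rw [Complex.cos, norm_div, Complex.norm_ofNat]
  linarith [norm_add_le (Complex.exp (z * Complex.I)) (Complex.exp (-z * Complex.I))]

lemma norm_sin_le_exp_abs_im (z : ℂ) : ‖Complex.sin z‖ ≤ Real.exp |z.im| := by
  have h1 : ‖Complex.exp (z * Complex.I)‖ ≤ Real.exp |z.im| := by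
    rw [Complex.norm_exp]
    exact Real.exp_le_exp.2 (by simpa using neg_le_abs z.im)
  have h2 : ‖Complex.exp (-z * Complex.I)‖ ≤ Real.exp |z.im| := by
    rw [Complex.norm_exp]
    exact Real.exp_le_exp.2 (by simpa using le_abs_self z.im)
  rw [Complex.sin, norm_div, norm_mul, Complex.norm_I, Complex.norm_ofNat]
  linarith [norm_sub_le (Complex.exp (-z * Complex.I)) (Complex.exp (z * Complex.I))]

lemma abs_im_add_mul_le (L : E →L[ℝ] ℝ) (x y : E) (z : ℂ) :
    |((L x : ℂ) + z * L y).im| ≤ ‖L‖ * (‖z‖ * ‖y‖) := by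
  have h : ((L x : ℂ) + z * L y).im = z.im * L y := by simp
  rw [h, abs_mul]
  calc |z.im| * |L y| ≤ ‖z‖ * (‖L‖ * ‖y‖) :=
        mul_le_mul (Complex.abs_im_le_norm z) (L.le_opNorm y) (abs_nonneg _) (norm_nonneg _)
    _ = _ := by ring

lemma expType_cos (L : E →L[ℝ] ℝ) : ExpType (fun _ => 1) fun x => Real.cos (L x) := by
  refine ⟨Real.contDiff_cos.comp L.contDiff, 1, zero_le_one, ‖L‖, norm_nonneg _, fun x y =>
    ⟨fun z => Complex.cos (L x + z * L y), by fun_prop, fun τ => by simp, fun z => ?_⟩⟩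
  rw [_root_.one_mul, _root_.one_mul]
  exact (norm_cos_le_exp_abs_im _).trans (Real.exp_le_exp.2 (abs_im_add_mul_le L x y z))

lemma expType_sin (L : E →L[ℝ] ℝ) : ExpType (fun _ => 1) fun x => Real.sin (L x) := by
  refine ⟨Real.contDiff_sin.comp L.contDiff, 1, zero_le_one, ‖L‖, norm_nonneg _, fun x y =>
    ⟨fun z => Complex.sin (L x + z * L y), by fun_prop, fun τ => by simp, fun z => ?_⟩⟩
  rw [_root_.one_mul, _root_.one_mul]
  exact (norm_sin_le_exp_abs_im _).trans (Real.exp_le_exp.2 (abs_im_add_mul_le L x y z))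

lemma expType_exp (L : E →L[ℝ] ℝ) :
    ExpType (fun x => Real.exp (L x)) fun x => Real.exp (L x) := by
  refine ⟨Real.contDiff_exp.comp L.contDiff, 1, zero_le_one, ‖L‖, norm_nonneg _, fun x y =>
    ⟨fun z => Complex.exp (L x + z * L y), by fun_prop, fun τ => by simp, fun z => ?_⟩⟩
  rw [_root_.one_mul, Complex.norm_exp, ← Real.exp_add, Real.exp_le_exp]
  have h : ((L x : ℂ) + z * L y).re = L x + z.re * L y := by simp
  rw [h]
  have : z.re * L y ≤ ‖z‖ * (‖L‖ * ‖y‖) := (le_abs_self _).trans <| by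
    rw [abs_mul]
    exact mul_le_mul (Complex.abs_re_le_norm z) (L.le_opNorm y) (abs_nonneg _) (norm_nonneg _)
  linarith

/-- The homogeneous Taylor polynomial of degree `k` at `x`. -/
def taylorTerm (ψ : E → ℝ) (k : ℕ) (x y : E) : ℝ :=
  (k.factorial : ℝ)⁻¹ * iteratedFDeriv ℝ k ψ x fun _ => y

/-- The derivatives on the real line of the real part of an entire function. -/
lemma iteratedDeriv_eq_re {g : ℂ → ℂ} (hg : Differentiable ℂ g) (k : ℕ) (τ : ℝ) :
    iteratedDeriv k (fun τ : ℝ => (g τ).re) τ = (iteratedDeriv k g τ).re := by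
  induction k generalizing τ with
  | zero => simp
  | succ k ih =>
    rw [iteratedDeriv_succ, iteratedDeriv_succ, funext ih]
    have hd : Differentiable ℂ (iteratedDeriv k g) :=
      (hg.contDiff (n := ⊤)).differentiable_iteratedDeriv k (WithTop.coe_lt_top _)
    exact (hd (τ : ℂ)).hasDerivAt.real_of_complex.deriv

lemma iteratedDeriv_line {ψ : E → ℝ} (hψ : ContDiff ℝ (⊤ : ℕ∞) ψ) (k : ℕ) (x y : E) :
    iteratedDeriv k (fun τ : ℝ => ψ (x + τ • y)) 0 = iteratedFDeriv ℝ k ψ x fun _ => y := by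
  let u : ℝ →L[ℝ] E := ContinuousLinearMap.toSpanSingleton ℝ y
  have hc : ContDiff ℝ (⊤ : ℕ∞) fun v => ψ (x + v) := hψ.comp (contDiff_const.add contDiff_id)
  have h := u.iteratedFDeriv_comp_right hc 0 (i := k) (by exact_mod_cast le_top)
  have e : (fun τ : ℝ => ψ (x + τ • y)) = (fun v => ψ (x + v)) ∘ u := rfl
  rw [iteratedDeriv_eq_iteratedFDeriv, e, h, map_zero, iteratedFDeriv_comp_add_left, add_zero]
  simp [u]

/-- The Taylor series of a function of exponential type converges everywhere, with Cauchy's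
estimate on the disc of radius `2` for its terms. -/
lemma ExpType.taylor {W ψ : E → ℝ} (h : ExpType W ψ) : ∃ C ≥ 0, ∃ c ≥ 0, ∀ x y : E,
    HasSum (fun k => taylorTerm ψ k x y) (ψ (x + y)) ∧
    ∀ k, |taylorTerm ψ k x y| ≤ C * W x * Real.exp (c * ‖y‖) * (1 / 2) ^ k := by
  obtain ⟨hψ, C, hC, c, hc, h⟩ := h
  refine ⟨C, hC, 2 * c, by positivity, fun x y => ?_⟩
  obtain ⟨g, hg, he, hb⟩ := h x y
  have hT (k : ℕ) : taylorTerm ψ k x y = (k.factorial : ℝ)⁻¹ * (iteratedDeriv k g 0).re := by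
    have h0 := iteratedDeriv_eq_re hg k 0
    simp only [he, Complex.ofReal_re, Complex.ofReal_zero] at h0
    rw [taylorTerm, ← iteratedDeriv_line hψ, h0]
  refine ⟨?_, fun k => ?_⟩
  · have hs := Complex.hasSum_taylorSeries_of_entire hg 0 1
    have hs' := Complex.reCLM.hasSum hs
    have h1 : g 1 = ψ (x + y) := by simpa using he 1
    rw [h1] at hs'
    convert! hs' using 2 with k
    rw [hT]
    have : ((k.factorial : ℂ)⁻¹) = (((k.factorial : ℝ)⁻¹ : ℝ) : ℂ) := by simp
    simp [this, -Complex.ofReal_inv]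
  · have hk := Complex.norm_iteratedDeriv_le_of_forall_mem_sphere_norm_le (c := 0) (f := g) k
      (zero_lt_two) hg.diffContOnCl (C := C * W x * Real.exp (2 * c * ‖y‖)) fun z hz => by
        have hz' : ‖z‖ = 2 := by simpa using hz
        refine (hb z).trans_eq ?_
        rw [hz']
        ring_nf
    rw [hT, abs_mul, abs_of_pos (by positivity)]
    have hf : (0 : ℝ) < k.factorial := by positivity
    calc _ ≤ (k.factorial : ℝ)⁻¹ *
          (k.factorial * (C * W x * Real.exp (2 * c * ‖y‖)) / 2 ^ k) := by
          gcongr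
          exact (Complex.abs_re_le_norm _).trans hk
      _ = _ := by
        rw [one_div, inv_pow]
        field_simp

end ExpType

/-! ### The functions `cos √z` and `sin √z / √z` -/

section CosSqrt

lemma differentiable_tsum_pow {a : ℕ → ℂ} (ha : ∀ k, ‖a k‖ ≤ (k.factorial : ℝ)⁻¹) :
    Differentiable ℂ fun z => ∑' k, a k * z ^ k := by
  intro z₀
  have hd : DifferentiableOn ℂ (fun z => ∑' k, a k * z ^ k) (Metric.ball 0 (‖z₀‖ + 1)) := by
    refine Complex.differentiableOn_tsum_of_summable_norm
      (Real.summable_pow_div_factorial (‖z₀‖ + 1)) (fun k => by fun_prop) Metric.isOpen_ball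
      fun k z hz => ?_
    rw [norm_mul, norm_pow, div_eq_inv_mul]
    have : ‖z‖ ≤ ‖z₀‖ + 1 := by simpa using (Metric.mem_ball.1 hz).le
    gcongr
    exact ha k
  exact hd.differentiableAt (Metric.isOpen_ball.mem_nhds (by simp))

lemma norm_tsum_pow_le {a : ℕ → ℂ} (ha : ∀ k, ‖a k‖ ≤ (k.factorial : ℝ)⁻¹) (z : ℂ) :
    ‖∑' k, a k * z ^ k‖ ≤ Real.exp ‖z‖ := by
  have h : HasSum (fun k : ℕ => ‖z‖ ^ k / k.factorial) (Real.exp ‖z‖) := by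
    rw [Real.exp_eq_exp_ℝ]
    exact NormedSpace.expSeries_div_hasSum_exp _
  refine tsum_of_norm_bounded h fun k => ?_
  rw [norm_mul, norm_pow, div_eq_inv_mul]
  gcongr
  exact ha k

/-- The entire function `cos √z`. -/
def cosSqrt (z : ℂ) : ℂ := ∑' k : ℕ, (-1) ^ k / ((2 * k).factorial : ℂ) * z ^ k

/-- The entire function `sin √z / √z`. -/
def sincSqrt (z : ℂ) : ℂ := ∑' k : ℕ, (-1) ^ k / ((2 * k + 1).factorial : ℂ) * z ^ k

lemma norm_coeff_le {k m : ℕ} (h : k ≤ m) :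
    ‖(-1 : ℂ) ^ k / (m.factorial : ℂ)‖ ≤ (k.factorial : ℝ)⁻¹ := by
  rw [norm_div, norm_pow, norm_neg, norm_one, one_pow, Complex.norm_natCast, one_div]
  have := Nat.factorial_le h
  gcongr

lemma differentiable_cosSqrt : Differentiable ℂ cosSqrt :=
  differentiable_tsum_pow fun k => norm_coeff_le (by omega)

lemma differentiable_sincSqrt : Differentiable ℂ sincSqrt :=
  differentiable_tsum_pow fun k => norm_coeff_le (by omega)

lemma cosSqrt_sq (w : ℂ) : cosSqrt (w ^ 2) = Complex.cos w := by
  rw [← (Complex.hasSum_cos w).tsum_eq, cosSqrt]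
  refine tsum_congr fun k => ?_
  rw [← pow_mul]
  ring

lemma sincSqrt_sq_mul (w : ℂ) : sincSqrt (w ^ 2) * w = Complex.sin w := by
  rw [← (Complex.hasSum_sin w).tsum_eq, sincSqrt, ← tsum_mul_right]
  refine tsum_congr fun k => ?_
  rw [← pow_mul]
  ring

/-- The decay of `sin w / w` for large `w` compensates a factor that grows linearly in `w`. -/
lemma norm_sincSqrt_sq_le (w : ℂ) :
    ‖sincSqrt (w ^ 2)‖ * (1 + ‖w‖) ≤ 2 * Real.exp 1 * Real.exp |w.im| := by
  have h1 : 1 ≤ Real.exp |w.im| := Real.one_le_exp (abs_nonneg _)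
  have he : 1 ≤ Real.exp 1 := Real.one_le_exp zero_le_one
  rcases le_total ‖w‖ 1 with hw | hw
  · have h : ‖sincSqrt (w ^ 2)‖ ≤ Real.exp 1 := by
      refine (norm_tsum_pow_le (fun k => norm_coeff_le (by omega)) _).trans ?_
      rw [Real.exp_le_exp, norm_pow]
      exact pow_le_one₀ (norm_nonneg _) hw
    calc _ ≤ Real.exp 1 * (1 + 1) := by gcongr
      _ ≤ _ := by nlinarith
  · have h : ‖sincSqrt (w ^ 2)‖ * ‖w‖ ≤ Real.exp |w.im| := by
      rw [← norm_mul, sincSqrt_sq_mul]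
      exact norm_sin_le_exp_abs_im w
    nlinarith [norm_nonneg (sincSqrt (w ^ 2))]

variable {ι : Type*} [Fintype ι]

/-- Bounds for a square root `w` of `∑ (X_j + i Y_j)²`, from
`Re w² = |X|² - |Y|²` and `Re w · Im w = ⟨X, Y⟩`. -/
lemma sqrt_sum_sq_bounds (X Y : EuclideanSpace ℝ ι) (w : ℂ)
    (hw : w ^ 2 = ∑ j, ((X j : ℂ) + Y j * Complex.I) ^ 2) :
    |w.im| ≤ ‖Y‖ ∧ ‖X‖ ≤ ‖w‖ + ‖Y‖ := by
  have hre : w.re ^ 2 - w.im ^ 2 = ‖X‖ ^ 2 - ‖Y‖ ^ 2 := by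
    have := congrArg Complex.re hw
    rw [Complex.re_sum] at this
    simp only [pow_two, Complex.mul_re, Complex.add_re, Complex.add_im, Complex.mul_im,
      Complex.ofReal_re, Complex.ofReal_im, Complex.I_re, Complex.I_im, mul_zero,
      _root_.mul_one, add_zero, zero_add, sub_zero, Finset.sum_sub_distrib] at this
    rw [EuclideanSpace.real_norm_sq_eq, EuclideanSpace.real_norm_sq_eq]
    simpa only [pow_two] using this
  have him : w.re * w.im = inner ℝ X Y := by
    have := congrArg Complex.im hw
    rw [Complex.im_sum] at this
    simp only [pow_two, Complex.mul_re, Complex.add_re, Complex.add_im, Complex.mul_im,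
      Complex.ofReal_re, Complex.ofReal_im, Complex.I_re, Complex.I_im, mul_zero,
      _root_.mul_one, add_zero, zero_add, sub_zero, Finset.sum_add_distrib] at this
    rw [PiLp.inner_apply]
    simp only [RCLike.inner_apply, conj_trivial]
    have e : ∑ j, X j * Y j = ∑ j, Y j * X j := Finset.sum_congr rfl fun j _ => mul_comm _ _
    linarith
  constructor
  · refine abs_le_of_sq_le_sq ?_ (norm_nonneg _)
    by_contra! hlt
    have h1 : (w.re * w.im) ^ 2 ≤ (‖X‖ * ‖Y‖) ^ 2 := by
      rw [him, ← sq_abs]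
      gcongr
      exact abs_real_inner_le_norm X Y
    have h2 : w.re ^ 2 = ‖X‖ ^ 2 - ‖Y‖ ^ 2 + w.im ^ 2 := by linarith
    rw [mul_pow, mul_pow, h2] at h1
    nlinarith [sq_nonneg ‖X‖, sq_nonneg ‖Y‖]
  · refine le_of_sq_le_sq ?_ (by positivity)
    have h3 : ‖w‖ ^ 2 = w.re ^ 2 + w.im ^ 2 := by
      rw [Complex.sq_norm, Complex.normSq_apply]
      ring
    nlinarith [norm_nonneg w, norm_nonneg Y, sq_nonneg w.im]

variable {E : Type*} [NormedAddCommGroup E] [NormedSpace ℝ E]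

lemma contDiff_re_comp_norm_sq {F : ℂ → ℂ} (hF : Differentiable ℂ F)
    (A : E →L[ℝ] EuclideanSpace ℝ ι) :
    ContDiff ℝ (⊤ : ℕ∞) fun x => (F ((‖A x‖ ^ 2 : ℝ) : ℂ)).re :=
  Complex.reCLM.contDiff.comp ((hF.contDiff.restrict_scalars ℝ).comp
    (Complex.ofRealCLM.contDiff.comp ((contDiff_norm_sq ℝ).comp A.contDiff)))

lemma ofReal_re_eq_of_real {F : ℂ → ℂ} {s : ℝ} (h : ∃ v : ℝ, F s = v) : ((F s).re : ℂ) = F s := by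
  obtain ⟨v, hv⟩ := h
  simp [hv]

lemma cosSqrt_ofReal (s : ℝ) : ((cosSqrt s).re : ℂ) = cosSqrt s := by
  refine ofReal_re_eq_of_real ⟨∑' k : ℕ, (-1) ^ k / ((2 * k).factorial : ℝ) * s ^ k, ?_⟩
  rw [cosSqrt, Complex.ofReal_tsum]
  push_cast
  rfl

lemma sincSqrt_ofReal (s : ℝ) : ((sincSqrt s).re : ℂ) = sincSqrt s := by
  refine ofReal_re_eq_of_real ⟨∑' k : ℕ, (-1) ^ k / ((2 * k + 1).factorial : ℝ) * s ^ k, ?_⟩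
  rw [sincSqrt, Complex.ofReal_tsum]
  push_cast
  rfl

/-- The function `sin s / s`, through the entire function `sincSqrt`. -/
def rsinc (s : ℝ) : ℝ := (sincSqrt ((s ^ 2 : ℝ) : ℂ)).re

lemma rsinc_mul (s : ℝ) : rsinc s * s = Real.sin s := by
  have h := sincSqrt_sq_mul s
  rw [← Complex.ofReal_pow, ← sincSqrt_ofReal] at h
  exact_mod_cast h

lemma re_cosSqrt (s : ℝ) : (cosSqrt ((s ^ 2 : ℝ) : ℂ)).re = Real.cos s := by
  have h := cosSqrt_sq s
  rw [← Complex.ofReal_pow, ← cosSqrt_ofReal] at h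
  exact_mod_cast h

/-- The sum of squares `∑ (a_j + z b_j)²`, continuing `‖a + τ b‖²` to complex `z = τ`. -/
def lineSq (a b : EuclideanSpace ℝ ι) (z : ℂ) : ℂ := ∑ j, ((a j : ℂ) + z * b j) ^ 2

lemma differentiable_lineSq (a b : EuclideanSpace ℝ ι) : Differentiable ℂ (lineSq a b) := by
  unfold lineSq
  fun_prop

lemma lineSq_ofReal (a b : EuclideanSpace ℝ ι) (τ : ℝ) :
    lineSq a b τ = ((‖a + τ • b‖ ^ 2 : ℝ) : ℂ) := by
  rw [EuclideanSpace.real_norm_sq_eq]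
  simp [lineSq]

/-- A square root of `∑ (a_j + z b_j)²` has imaginary part at most `|z| |b|`, however large `a` is,
and it dominates the single `a_j + z b_j` up to an error of that size. -/
lemma exists_sq_eq_lineSq (a b : EuclideanSpace ℝ ι) (z : ℂ) :
    ∃ w : ℂ, w ^ 2 = lineSq a b z ∧ |w.im| ≤ ‖z‖ * ‖b‖ ∧
      ∀ j, ‖(a j : ℂ) + z * b j‖ ≤ ‖w‖ + 2 * (‖z‖ * ‖b‖) := by
  obtain ⟨w, hw⟩ := IsAlgClosed.exists_pow_nat_eq (lineSq a b z) (zero_lt_two)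
  have he (j : ι) : (a j : ℂ) + z * b j =
      ((a + z.re • b) j : ℝ) + ((z.im • b) j : ℝ) * Complex.I := by
    apply Complex.ext <;> simp
  have hY : ‖z.im • b‖ ≤ ‖z‖ * ‖b‖ := by
    rw [norm_smul]
    gcongr
    exact Complex.abs_im_le_norm z
  obtain ⟨h1, h2⟩ := sqrt_sum_sq_bounds (a + z.re • b) (z.im • b) w (by
    rw [hw, lineSq]
    exact Finset.sum_congr rfl fun j _ => by rw [he])
  refine ⟨w, hw, h1.trans hY, fun j => ?_⟩
  rw [he]
  calc _ ≤ ‖(a + z.re • b) j‖ + ‖(z.im • b) j‖ := by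
        refine (norm_add_le _ _).trans_eq ?_
        rw [norm_mul, Complex.norm_I, _root_.mul_one, Complex.norm_real, Complex.norm_real]
    _ ≤ ‖a + z.re • b‖ + ‖z.im • b‖ :=
        add_le_add (PiLp.norm_apply_le _ j) (PiLp.norm_apply_le _ j)
    _ ≤ _ := by linarith

lemma expType_cos_norm (A : E →L[ℝ] EuclideanSpace ℝ ι) :
    ExpType (fun _ => 1) fun x => Real.cos ‖A x‖ := by
  simp only [← re_cosSqrt]
  refine ⟨contDiff_re_comp_norm_sq differentiable_cosSqrt A, 1, zero_le_one, ‖A‖, norm_nonneg _,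
    fun x y => ⟨fun z => cosSqrt (lineSq (A x) (A y) z),
      differentiable_cosSqrt.comp (differentiable_lineSq _ _), fun τ => ?_, fun z => ?_⟩⟩
  · beta_reduce
    rw [lineSq_ofReal, ← cosSqrt_ofReal, map_add, map_smul]
  · obtain ⟨w, hw, h1, -⟩ := exists_sq_eq_lineSq (A x) (A y) z
    beta_reduce
    rw [← hw, cosSqrt_sq, _root_.one_mul, _root_.one_mul]
    refine (norm_cos_le_exp_abs_im w).trans (Real.exp_le_exp.2 (h1.trans ?_))
    calc ‖z‖ * ‖A y‖ ≤ ‖z‖ * (‖A‖ * ‖y‖) := by gcongr; exact A.le_opNorm y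
      _ = _ := by ring

lemma expType_sinc_norm_mul (A : E →L[ℝ] EuclideanSpace ℝ ι) (j : ι) :
    ExpType (fun _ => 1) fun x => rsinc ‖A x‖ * A x j := by
  refine ⟨(contDiff_re_comp_norm_sq differentiable_sincSqrt A).mul
      ((EuclideanSpace.proj (𝕜 := ℝ) j).contDiff.comp A.contDiff), 2 * Real.exp 1, by positivity,
    3 * ‖A‖, by positivity,
    fun x y => ⟨fun z => sincSqrt (lineSq (A x) (A y) z) * (A x j + z * A y j),
      (differentiable_sincSqrt.comp (differentiable_lineSq _ _)).mul (by fun_prop),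
      fun τ => ?_, fun z => ?_⟩⟩
  · beta_reduce
    rw [lineSq_ofReal, ← sincSqrt_ofReal, map_add, map_smul, rsinc]
    simp
  · obtain ⟨w, hw, h1, h2⟩ := exists_sq_eq_lineSq (A x) (A y) z
    have h3 : ‖z‖ * ‖A y‖ ≤ ‖A‖ * (‖z‖ * ‖y‖) := by
      calc ‖z‖ * ‖A y‖ ≤ ‖z‖ * (‖A‖ * ‖y‖) := by gcongr; exact A.le_opNorm y
        _ = _ := by ring
    have h4 := norm_sincSqrt_sq_le w
    rw [hw] at h4
    set m := ‖A‖ * (‖z‖ * ‖y‖) with hm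
    have hm0 : 0 ≤ m := by positivity
    rw [norm_mul, _root_.mul_one]
    calc ‖sincSqrt (lineSq (A x) (A y) z)‖ * ‖(A x j : ℂ) + z * A y j‖
        ≤ ‖sincSqrt (lineSq (A x) (A y) z)‖ * ((1 + ‖w‖) * (1 + 2 * m)) := by
          gcongr
          nlinarith [h2 j, norm_nonneg w]
      _ = ‖sincSqrt (lineSq (A x) (A y) z)‖ * (1 + ‖w‖) * (1 + 2 * m) := by ring
      _ ≤ 2 * Real.exp 1 * Real.exp m * Real.exp (2 * m) := by
          refine mul_le_mul (h4.trans ?_) ?_ (by positivity) (by positivity)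
          · gcongr
            exact h1.trans h3
          · linarith [Real.add_one_le_exp (2 * m)]
      _ = 2 * Real.exp 1 * Real.exp (3 * ‖A‖ * (‖z‖ * ‖y‖)) := by
          rw [_root_.mul_assoc, ← Real.exp_add]
          congr 2
          rw [hm]
          ring

end CosSqrt

/-! ### Local analyticity of parameter integrals -/

section Integrals

variable {r : ℕ}

/-- Local analyticity over `A_r` at one point. -/
def HolomorphicAt (g : CD r → CD r) (z₀ : CD r) : Prop :=
  ∃ ρ > (0 : ℝ), ∃ P : ℕ → CD r → CD r, ∃ b : ℕ → ℝ,
    (∀ k, P k ∈ homPoly r k) ∧ Summable b ∧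
    (∀ k, ∀ h : CD r, ‖h‖ < ρ → ‖P k h‖ ≤ b k) ∧
    ∀ h : CD r, ‖h‖ < ρ → HasSum (fun k => P k h) (g (z₀ + h))

lemma HolomorphicAt.congr {g g' : CD r → CD r} {z₀ : CD r} (h : HolomorphicAt g z₀)
    (hg : ∀ᶠ z in 𝓝 z₀, g z = g' z) : HolomorphicAt g' z₀ := by
  obtain ⟨ρ, hρ, P, b, hP, hb, hPb, hs⟩ := h
  obtain ⟨ε, hε, he⟩ := Metric.eventually_nhds_iff_ball.1 hg
  refine ⟨min ρ ε, lt_min hρ hε, P, b, hP, hb,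
    fun k x hx => hPb k x (hx.trans_le (min_le_left _ _)), fun x hx => ?_⟩
  rw [← he (z₀ + x) (by simpa using hx.trans_le (min_le_right _ _))]
  exact hs x (hx.trans_le (min_le_left _ _))

lemma HolomorphicAt.add {g g' : CD r → CD r} {z₀ : CD r} (h : HolomorphicAt g z₀)
    (h' : HolomorphicAt g' z₀) : HolomorphicAt (fun z => g z + g' z) z₀ := by
  obtain ⟨ρ, hρ, P, b, hP, hb, hPb, hs⟩ := h
  obtain ⟨ρ', hρ', P', b', hP', hb', hPb', hs'⟩ := h'
  refine ⟨min ρ ρ', lt_min hρ hρ', fun k => P k + P' k, fun k => b k + b' k,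
    fun k => Submodule.add_mem _ (hP k) (hP' k), hb.add hb', fun k x hx => ?_, fun x hx => ?_⟩
  · exact (norm_add_le _ _).trans (add_le_add (hPb k x (hx.trans_le (min_le_left _ _)))
      (hPb' k x (hx.trans_le (min_le_right _ _))))
  · exact (hs x (hx.trans_le (min_le_left _ _))).add (hs' x (hx.trans_le (min_le_right _ _)))

lemma HolomorphicAt.sum {ι : Type*} (s : Finset ι) {g : ι → CD r → CD r} {z₀ : CD r}
    (h : ∀ i ∈ s, HolomorphicAt (g i) z₀) : HolomorphicAt (fun z => ∑ i ∈ s, g i z) z₀ := by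
  classical
  induction s using Finset.induction_on with
  | empty =>
    refine ⟨1, one_pos, fun _ _ => 0, fun _ => 0, fun k => Submodule.zero_mem _, summable_zero,
      fun _ _ _ => by simp, fun _ _ => by simp⟩
  | insert a s ha ih =>
    simp only [Finset.sum_insert ha]
    exact (h a (by simp)).add (ih fun i hi => h i (by simp [hi]))

lemma Word.eval_smul (w : Word r) (c : ℝ) (h : CD r) :
    w.eval (c • h) = c ^ w.degree • w.eval h := by
  induction w with
  | const a => simp [Word.eval, Word.degree]
  | var => simp [Word.eval, Word.degree]
  | mul w₁ w₂ h₁ h₂ =>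
    simp only [Word.eval, Word.degree, h₁, h₂, smul_mul, mul_smul, smul_smul, pow_add]
    rw [mul_comm]

lemma apply_smul_of_mem_homPoly {k : ℕ} {P : CD r → CD r} (hP : P ∈ homPoly r k) (c : ℝ)
    (h : CD r) : P (c • h) = c ^ k • P h := by
  induction hP using Submodule.span_induction with
  | mem P hP =>
    obtain ⟨w, rfl, rfl⟩ := hP
    exact w.eval_smul c h
  | zero => simp
  | add P Q _ _ h₁ h₂ => simp [h₁, h₂]
  | smul a P _ h₁ => rw [Pi.smul_apply, Pi.smul_apply, h₁, smul_comm]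

/-- Term-by-term integration of power series over `A_r` with an integrable geometric
majorant. -/
lemma holomorphicAt_integral {Ω : Type*} [MeasurableSpace Ω] {μ : Measure Ω}
    {G : Ω → CD r → CD r} {Q : ℕ → Ω → CD r → CD r} (W : ℕ → Submodule ℝ (CD r → CD r))
    [∀ k, FiniteDimensional ℝ (W k)] (hW : ∀ k, W k ≤ homPoly r k) (hQ : ∀ k t, Q k t ∈ W k)
    (hmeas : ∀ k h, AEStronglyMeasurable (fun t => Q k t h) μ) {ρ : ℝ} (hρ : 0 < ρ) {B : Ω → ℝ}
    (hB : Integrable B μ) (hb : ∀ k t h, ‖h‖ < ρ → ‖Q k t h‖ ≤ B t * (1 / 2) ^ k)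
    (hs : ∀ t h, ‖h‖ < ρ → HasSum (fun k => Q k t h) (G t h)) {g : CD r → CD r} {z₀ : CD r}
    (hg : ∀ h, ‖h‖ < ρ → g (z₀ + h) = ∫ t, G t h ∂μ) : HolomorphicAt g z₀ := by
  -- The majorant is given on a ball only; homogeneity extends integrability to all `h`.
  have hint (k : ℕ) (h : CD r) : Integrable (fun t => Q k t h) μ := by
    obtain ⟨c, hc, hch⟩ : ∃ c : ℝ, 0 < c ∧ ‖c • h‖ < ρ := by
      refine ⟨ρ / (‖h‖ + 1), by positivity, ?_⟩
      rw [norm_smul, Real.norm_of_nonneg (by positivity), div_mul_eq_mul_div,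
        div_lt_iff₀ (by positivity)]
      nlinarith [norm_nonneg h]
    have hi : Integrable (fun t => Q k t (c • h)) μ :=
      (hB.mul_const ((1 / 2) ^ k)).mono' (hmeas k _) (.of_forall fun t => hb k t _ hch)
    have : (fun t => Q k t h) = fun t => (c ^ k)⁻¹ • Q k t (c • h) := by
      ext1 t
      rw [apply_smul_of_mem_homPoly (hW k (hQ k t)), smul_smul, inv_mul_cancel₀ (by positivity),
        one_smul]
    rw [this]
    exact hi.smul (c ^ k)⁻¹
  have hgeo : Summable fun k : ℕ => (1 / 2 : ℝ) ^ k := summable_geometric_two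
  refine ⟨ρ, hρ, fun k h => ∫ t, Q k t h ∂μ, fun k => (∫ t, B t ∂μ) * (1 / 2) ^ k,
    fun k => hW k (integral_mem_of_finiteDimensional (W k) (Q k) (hQ k) (hint k)),
    hgeo.mul_left _, fun k h hh => ?_, fun h hh => ?_⟩
  · beta_reduce
    rw [← integral_mul_const]
    exact norm_integral_le_of_norm_le (hB.mul_const _) (.of_forall fun t => hb k t h hh)
  · rw [hg h hh]
    refine hasSum_integral_of_dominated_convergence (fun k t => B t * (1 / 2) ^ k)
      (fun k => hmeas k h) (fun k => .of_forall fun t => hb k t h hh)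
      (.of_forall fun t => hgeo.mul_left _) ?_ (.of_forall fun t => hs t h hh)
    simp only [tsum_mul_left]
    exact hB.mul_const _

end Integrals

/-! ### Originals -/

section Originals

variable {r n : ℕ} {f : (Fin n → ℝ) → CD r} {a₁ am₁ : ℝ}

lemma IsOriginal.aestronglyMeasurable (hf : IsOriginal f a₁ am₁) : AEStronglyMeasurable f := by
  set s := {t | ContinuousAt f t}
  have hs : MeasurableSet s := measurableSet_of_continuousAt f
  have h : AEStronglyMeasurable f (volume.restrict s) :=
    ContinuousOn.aestronglyMeasurable (fun t ht => ContinuousAt.continuousWithinAt ht) hs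
  have hae : ∀ᵐ t, t ∈ s := hf.ae_continuous
  rwa [Measure.restrict_eq_self_of_ae_mem hae] at h

lemma IsOriginal.exists_bound (hf : IsOriginal f a₁ am₁) : ∃ C ≥ 0, ∀ t,
    ‖f t‖ ≤ C * Real.exp (∑ j, (if 0 ≤ t j then a₁ else am₁) * t j) := by
  choose C hC hb using hf.growth
  refine ⟨∑ v, C v, Finset.sum_nonneg fun v _ => (hC v).le, fun t => ?_⟩
  -- Where some `t_j = 0` several orthants contain `t`; the positive sign is taken there.
  let v : Fin n → ℤˣ := fun j => if 0 ≤ t j then 1 else -1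
  have h := hb v t fun j => by
    by_cases h0 : 0 ≤ t j
    · simp [v, h0]
    · simpa [v, h0] using (not_le.1 h0).le
  have e (j : Fin n) : (if v j = 1 then a₁ else am₁) = if 0 ≤ t j then a₁ else am₁ := by
    by_cases h0 : 0 ≤ t j <;> simp [v, h0, Units.ext_iff]
  simp only [e] at h
  refine h.le.trans ?_
  gcongr
  exact Finset.single_le_sum (fun v _ => (hC v).le) (Finset.mem_univ v)

/-- The sum `|t_1| + … + |t_n|`. -/
def absSum (t : Fin n → ℝ) : ℝ := ∑ j, |t j|

lemma absSum_nonneg (t : Fin n → ℝ) : 0 ≤ absSum t := Finset.sum_nonneg fun _ _ => abs_nonneg _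

lemma continuous_absSum : Continuous (absSum : (Fin n → ℝ) → ℝ) := by
  unfold absSum
  fun_prop

lemma integrable_exp_neg_absSum {ε : ℝ} (hε : 0 < ε) :
    Integrable fun t : Fin n → ℝ => Real.exp (-(ε * absSum t)) := by
  have h1 : Integrable fun s : ℝ => Real.exp (-(ε * |s|)) := by
    rw [← integrableOn_univ, ← Set.Iic_union_Ioi (a := (0 : ℝ)), integrableOn_union]
    constructor
    · refine (integrableOn_exp_mul_Iic hε 0).congr_fun (fun s hs => ?_) measurableSet_Iic
      simp [abs_of_nonpos (Set.mem_Iic.1 hs)]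
    · refine (integrableOn_exp_mul_Ioi (neg_lt_zero.2 hε) 0).congr_fun (fun s hs => ?_)
        measurableSet_Ioi
      simp [abs_of_pos (Set.mem_Ioi.1 hs)]
  have h2 := Integrable.fintype_prod (ι := Fin n) (μ := fun _ => (volume : Measure ℝ))
    (f := fun _ (s : ℝ) => Real.exp (-(ε * |s|))) fun _ => h1
  refine h2.congr (.of_forall fun t => ?_)
  simp [absSum, Finset.mul_sum, ← Real.exp_sum]

/-- In the interior of the strip the growth condition leaves room for a small exponential factor:
both `p₀ - a₁` and `a₋₁ - p₀` are at least `2ε`. -/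
lemma IsOriginal.exists_integrable (hf : IsOriginal f a₁ am₁) {p₀ : ℝ} (h₁ : a₁ < p₀)
    (h₂ : p₀ < am₁) : ∃ ε > 0, Integrable fun t =>
      Real.exp (-(p₀ * ∑ j, t j)) * Real.exp (ε * (1 + absSum t)) * ‖f t‖ := by
  obtain ⟨C, hC, hb⟩ := hf.exists_bound
  obtain ⟨ε, hε, he₁, he₂⟩ : ∃ ε > 0, 2 * ε ≤ p₀ - a₁ ∧ 2 * ε ≤ am₁ - p₀ :=
    ⟨min (p₀ - a₁) (am₁ - p₀) / 2, half_pos (lt_min (by linarith) (by linarith)),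
      by linarith [min_le_left (p₀ - a₁) (am₁ - p₀)],
      by linarith [min_le_right (p₀ - a₁) (am₁ - p₀)]⟩
  refine ⟨ε, hε, ((integrable_exp_neg_absSum hε).const_mul (C * Real.exp ε)).mono' ?_
    (.of_forall fun t => ?_)⟩
  · have := continuous_absSum (n := n)
    exact (Continuous.aestronglyMeasurable (by fun_prop)).mul hf.aestronglyMeasurable.norm
  · rw [Real.norm_of_nonneg (by positivity)]
    calc _ ≤ Real.exp (-(p₀ * ∑ j, t j)) * Real.exp (ε * (1 + absSum t)) *
          (C * Real.exp (∑ j, (if 0 ≤ t j then a₁ else am₁) * t j)) := by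
          gcongr
          exact hb t
      _ = C * Real.exp (-(p₀ * ∑ j, t j) + ε * (1 + absSum t) +
          ∑ j, (if 0 ≤ t j then a₁ else am₁) * t j) := by
          rw [Real.exp_add, Real.exp_add]
          ring
      _ ≤ C * Real.exp (ε + -(ε * absSum t)) := by
          gcongr C * Real.exp ?_
          have : ∑ j, (if 0 ≤ t j then a₁ else am₁) * t j ≤
              ∑ j, (p₀ * t j - 2 * ε * |t j|) := by
            refine Finset.sum_le_sum fun j _ => ?_
            split_ifs with h0
            · rw [abs_of_nonneg h0]
              nlinarith
            · rw [abs_of_neg (not_le.1 h0)]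
              nlinarith
          rw [Finset.sum_sub_distrib, ← Finset.mul_sum, ← Finset.mul_sum] at this
          simp only [absSum]
          linarith
      _ = _ := by rw [Real.exp_add]; ring

/-- The weight `e^{-x_0}`. -/
def expWeight (x : CD r) : ℝ := Real.exp (-x ⟨0, by positivity⟩)

/-- Local analyticity of the integral formed with one real coordinate `ψ` of `exp (-u)`, a function
of `2^r` real arguments that depend affinely on the parameter `h`. -/
lemma IsOriginal.holomorphicAt_integral (hf : IsOriginal f a₁ am₁) (hr : 2 ≤ r) {p₀ c₀ : ℝ}
    (h₁ : a₁ < p₀) (h₂ : p₀ < am₁) {ψ : CD r → ℝ} (hψ : ExpType expWeight ψ)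
    {x : (Fin n → ℝ) → CD r} (hx : Continuous x)
    (hx0 : ∀ t, x t ⟨0, by positivity⟩ = p₀ * ∑ j, t j + c₀)
    {ℓ : (Fin n → ℝ) → CD r →L[ℝ] CD r} (hℓ : ∀ h, Continuous fun t => ℓ t h)
    (hℓb : ∀ t h, ‖ℓ t h‖ ≤ (1 + absSum t) * ‖h‖) (a : CD r) {g : CD r → CD r} {z₀ : CD r}
    (hg : ∀ h, g (z₀ + h) = ∫ t, ψ (x t + ℓ t h) • mul (f t) a) : HolomorphicAt g z₀ := by
  obtain ⟨ε, hε, hint⟩ := hf.exists_integrable h₁ h₂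
  obtain ⟨C, hC, c, hc, hT⟩ := hψ.taylor
  let R : CD r →L[ℝ] CD r := LinearMap.toContinuousLinearMap ((mulₗ r).flip a)
  have hR (z : CD r) : R z = mul z a := rfl
  -- On this radius `c ‖ℓ t h‖ ≤ ε (1 + ∑ |t_j|)`; `c` itself may be zero.
  refine CD.holomorphicAt_integral (W := realHomPoly r) (ρ := ε / (c + 1))
    (Q := fun k t h => taylorTerm ψ k (x t) (ℓ t h) • mul (f t) a)
    (G := fun t h => ψ (x t + ℓ t h) • mul (f t) a)
    (B := fun t => C * Real.exp (-c₀) * ‖R‖ *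
      (Real.exp (-(p₀ * ∑ j, t j)) * Real.exp (ε * (1 + absSum t)) * ‖f t‖))
    (realHomPoly_le_homPoly hr) (fun k t => ?_) (fun k h => ?_) (by positivity)
    (hint.const_mul _) (fun k t h hh => ?_) (fun t h _ => ?_) (fun h _ => hg h)
  · let M : MultilinearMap ℝ (fun _ : Fin k => CD r) ℝ :=
      ((k.factorial : ℝ)⁻¹ • iteratedFDeriv ℝ k ψ (x t)).toMultilinearMap.compLinearMap
        fun _ => (ℓ t).toLinearMap
    exact diag_mem_realHomPoly (M.smulRight (mul (f t) a))
  · have h1 : Continuous fun t => iteratedFDeriv ℝ k ψ (x t) :=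
      (hψ.1.continuous_iteratedFDeriv (by exact_mod_cast le_top)).comp hx
    have h2 : Continuous fun t => taylorTerm ψ k (x t) (ℓ t h) := by
      have h3 : Continuous fun t => iteratedFDeriv ℝ k ψ (x t) fun _ => ℓ t h :=
        h1.eval (continuous_pi fun _ => hℓ h)
      exact continuous_const.mul h3
    exact h2.aestronglyMeasurable.smul
      (R.continuous.comp_aestronglyMeasurable hf.aestronglyMeasurable)
  · have hS := absSum_nonneg t
    have hcε : c * ‖ℓ t h‖ ≤ ε * (1 + absSum t) := by
      calc c * ‖ℓ t h‖ ≤ (c + 1) * ((1 + absSum t) * (ε / (c + 1))) := by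
            have := (hℓb t h).trans (mul_le_mul_of_nonneg_left hh.le (by positivity))
            gcongr
            linarith
        _ = _ := by field_simp
    rw [norm_smul, Real.norm_eq_abs, ← hR]
    calc _ ≤ (C * expWeight (x t) * Real.exp (ε * (1 + absSum t)) * (1 / 2) ^ k) *
          (‖R‖ * ‖f t‖) := by
          have hw : 0 ≤ expWeight (x t) := (Real.exp_pos _).le
          refine mul_le_mul (((hT _ _).2 k).trans ?_) (R.le_opNorm _) (norm_nonneg _)
            (by positivity)
          gcongr
      _ = _ := by
          rw [expWeight, hx0, neg_add, Real.exp_add]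
          ring
  · exact ((hT (x t) (ℓ t h)).1).smul_const _

lemma IsOriginal.integrable_smul_mul (hf : IsOriginal f a₁ am₁) {p₀ c₀ : ℝ}
    (h₁ : a₁ < p₀) (h₂ : p₀ < am₁) {ψ : CD r → ℝ} (hψ : ExpType expWeight ψ)
    {x : (Fin n → ℝ) → CD r} (hx : Continuous x)
    (hx0 : ∀ t, x t ⟨0, by positivity⟩ = p₀ * ∑ j, t j + c₀) (a : CD r) :
    Integrable fun t => ψ (x t) • mul (f t) a := by
  obtain ⟨ε, hε, hint⟩ := hf.exists_integrable h₁ h₂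
  obtain ⟨hd, C, hC, c, hc, hT⟩ := hψ
  let R : CD r →L[ℝ] CD r := LinearMap.toContinuousLinearMap ((mulₗ r).flip a)
  have hR (z : CD r) : R z = mul z a := rfl
  refine (hint.const_mul (C * Real.exp (-c₀) * ‖R‖)).mono'
    ((hd.continuous.comp hx).aestronglyMeasurable.smul
      (R.continuous.comp_aestronglyMeasurable hf.aestronglyMeasurable)) (.of_forall fun t => ?_)
  have hS := absSum_nonneg t
  obtain ⟨g, -, he, hb⟩ := hT (x t) 0
  have hψt : |ψ (x t)| ≤ C * expWeight (x t) := by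
    have h0 := hb ((0 : ℝ) : ℂ)
    rw [he 0] at h0
    simpa using h0
  rw [norm_smul, Real.norm_eq_abs, ← hR]
  have hw : 0 ≤ expWeight (x t) := (Real.exp_pos _).le
  calc _ ≤ (C * expWeight (x t)) * (‖R‖ * ‖f t‖) :=
        mul_le_mul hψt (R.le_opNorm _) (norm_nonneg _) (by positivity)
    _ = C * Real.exp (-c₀) * ‖R‖ * (Real.exp (-(p₀ * ∑ j, t j)) * 1 * ‖f t‖) := by
        rw [expWeight, hx0, neg_add, Real.exp_add]
        ring
    _ ≤ _ := by
        gcongr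
        exact Real.one_le_exp (by positivity)

end Originals

/-! ### The complex case `r = 1` -/

section Complex

/-- The identification of `A_1` with the complex numbers. -/
def toComplex : CD 1 ≃ₗᵢ[ℝ] ℂ := Complex.orthonormalBasisOneI.repr.symm

lemma toComplex_apply (z : CD 1) : toComplex z = (z 0 : ℂ) + (z 1 : ℂ) * Complex.I :=
  Complex.orthonormalBasisOneI_repr_symm_apply z

lemma toComplex_mul (x y : CD 1) : toComplex (mul x y) = toComplex x * toComplex y := by
  simp only [toComplex_apply]
  -- The conjugation of `A_0 = ℝ` is the identity.
  have h0 : (mul x y) 0 = x 0 * y 0 - y 1 * x 1 := rfl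
  have h1 : (mul x y) 1 = y 1 * x 0 + x 1 * y 0 := rfl
  rw [h0, h1]
  apply Complex.ext <;> simp <;> ring

lemma toComplex_npow (z : CD 1) (k : ℕ) : toComplex (npow z k) = toComplex z ^ k := by
  induction k with
  | zero =>
    rw [npow, toComplex_apply, pow_zero]
    have h0 : (gen 1 0 : CD 1) 0 = 1 := by simp [gen]
    have h1 : (gen 1 0 : CD 1) 1 = 0 := by simp [gen]
    simp [h0, h1]
  | succ k ih => rw [npow, toComplex_mul, ih, ← pow_succ]

lemma hasSum_complex_exp (z : ℂ) : HasSum (fun k : ℕ => z ^ k / k.factorial) (Complex.exp z) := by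
  rw [Complex.exp_eq_exp_ℂ]
  exact NormedSpace.expSeries_div_hasSum_exp z

lemma toComplex_exp (z : CD 1) : toComplex (exp z) = Complex.exp (toComplex z) := by
  have h : toComplex (exp z) = ∑' k : ℕ, toComplex (((k.factorial : ℝ)⁻¹) • npow z k) :=
    toComplex.toContinuousLinearEquiv.map_tsum
  rw [h, ← (hasSum_complex_exp (toComplex z)).tsum_eq]
  refine tsum_congr fun k => ?_
  rw [map_smul, toComplex_npow, div_eq_inv_mul, Complex.real_smul]
  simp

/-- The functions `h ↦ c h^k` on `A_1`. -/
def monomials (k : ℕ) : Submodule ℝ (CD 1 → CD 1) :=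
  LinearMap.range ({ toFun := fun c h => mul c (npow h k)
                     map_add' := fun c d => by ext1 h; exact add_mul c d _
                     map_smul' := fun a c => by ext1 h; exact smul_mul a c _ } :
    CD 1 →ₗ[ℝ] (CD 1 → CD 1))

instance (k : ℕ) : FiniteDimensional ℝ (monomials k) := by
  unfold monomials
  infer_instance

lemma monomials_le_homPoly (k : ℕ) : monomials k ≤ homPoly 1 k := by
  rintro _ ⟨c, rfl⟩
  simpa using mul_mem_homPoly (const_mem_homPoly c) (npow_mem_homPoly k)

variable {n : ℕ} {f : (Fin n → ℝ) → CD 1} {a₁ am₁ : ℝ}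

/-- For `r = 1` the exponential series in `s(t) h`, with a real factor `s(t)`, can be integrated
term by term and gives terms `c h^k`. -/
lemma IsOriginal.holomorphicAt_integral_one (hf : IsOriginal f a₁ am₁) {p₀ c₀ : ℝ}
    (h₁ : a₁ < p₀) (h₂ : p₀ < am₁) {x : (Fin n → ℝ) → CD 1} (hx : Continuous x)
    (hx0 : ∀ t, x t 0 = p₀ * ∑ j, t j + c₀) {s : (Fin n → ℝ) → ℝ} (hs : Continuous s)
    (hsb : ∀ t, |s t| ≤ 1 + absSum t) {g : CD 1 → CD 1} {z₀ : CD 1}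
    (hg : ∀ h, g (z₀ + h) = ∫ t, mul (f t) (exp (-(x t + s t • h)))) : HolomorphicAt g z₀ := by
  obtain ⟨ε, hε, hint⟩ := hf.exists_integrable h₁ h₂
  let κ := toComplex
  let Q : ℕ → (Fin n → ℝ) → CD 1 → CD 1 := fun k t h =>
    κ.symm (κ (f t) * Complex.exp (-κ (x t)) * ((-(s t * κ h)) ^ k / k.factorial))
  refine CD.holomorphicAt_integral (W := monomials) (ρ := ε / 2) (Q := Q)
    (G := fun t h => mul (f t) (exp (-(x t + s t • h))))
    (B := fun t => Real.exp (-c₀) *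
      (Real.exp (-(p₀ * ∑ j, t j)) * Real.exp (ε * (1 + absSum t)) * ‖f t‖))
    monomials_le_homPoly (fun k t => ?_) (fun k h => ?_) (by positivity)
    (hint.const_mul _) (fun k t h hh => ?_) (fun t h _ => ?_) (fun h _ => hg h)
  · refine ⟨κ.symm (κ (f t) * Complex.exp (-κ (x t)) * ((-(s t : ℂ)) ^ k / k.factorial)), ?_⟩
    ext1 h
    apply κ.injective
    change κ (mul _ (npow h k)) = _
    rw [toComplex_mul, toComplex_npow]
    simp only [Q, κ, LinearIsometryEquiv.apply_symm_apply]
    ring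
  · have hκ : Continuous κ := κ.continuous
    refine κ.symm.continuous.comp_aestronglyMeasurable
      (((hκ.comp_aestronglyMeasurable hf.aestronglyMeasurable).mul ?_).mul ?_)
    · exact Continuous.aestronglyMeasurable (by fun_prop)
    · exact Continuous.aestronglyMeasurable (by fun_prop)
  · have hre : (κ (x t)).re = x t 0 := by simp [κ, toComplex_apply]
    have hS := absSum_nonneg t
    have h2 : 2 * (|s t| * ‖h‖) ≤ ε * (1 + absSum t) := by
      have : |s t| * ‖h‖ ≤ (1 + absSum t) * (ε / 2) := by
        gcongr
        exact hsb t
      linarith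
    have h3 : (|s t| * ‖h‖) ^ k / k.factorial ≤
        Real.exp (ε * (1 + absSum t)) * (1 / 2) ^ k := by
      have := (Real.pow_div_factorial_le_exp (2 * (|s t| * ‖h‖)) (by positivity) k).trans
        (Real.exp_le_exp.2 h2)
      rw [mul_pow] at this
      rw [one_div, inv_pow, ← div_eq_mul_inv, le_div_iff₀ (by positivity)]
      refine le_of_eq_of_le ?_ this
      ring
    simp only [Q]
    rw [LinearIsometryEquiv.norm_map, norm_mul, norm_mul, norm_div, norm_pow, norm_neg, norm_mul,
      Complex.norm_real, LinearIsometryEquiv.norm_map, LinearIsometryEquiv.norm_map,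
      Complex.norm_natCast, Complex.norm_exp, Complex.neg_re, hre, hx0, neg_add, Real.exp_add,
      Real.norm_eq_abs]
    calc _ ≤ ‖f t‖ * (Real.exp (-(p₀ * ∑ j, t j)) * Real.exp (-c₀)) *
          (Real.exp (ε * (1 + absSum t)) * (1 / 2) ^ k) := by gcongr
      _ = _ := by ring
  · have h1 := (hasSum_complex_exp (-(s t * κ h))).mul_left
      (κ (f t) * Complex.exp (-κ (x t)))
    have h2 := κ.symm.toContinuousLinearEquiv.toContinuousLinearMap.hasSum h1
    convert! h2 using 1
    apply κ.injective
    change toComplex (mul (f t) (exp (-(x t + s t • h)))) = toComplex (toComplex.symm _)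
    rw [toComplex_mul, toComplex_exp, LinearIsometryEquiv.apply_symm_apply, map_neg, map_add,
      map_smul, Complex.real_smul, neg_add, Complex.exp_add, _root_.mul_assoc]

end Complex

/-! ### The exponential of `-u` as a function of real arguments -/

section Factorization

variable {r n : ℕ}

/-- The diagonal operator with real entries `ℓ_j`. -/
def diagL (ℓ : Fin (2 ^ r) → ℝ) : CD r →L[ℝ] CD r :=
  LinearMap.toContinuousLinearMap
    { toFun := fun p => WithLp.toLp 2 fun j => ℓ j * p j
      map_add' := fun p q => by ext j; simp [_root_.mul_add]
      map_smul' := fun c p => by ext j; simp [mul_left_comm] }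

@[simp] lemma diagL_apply (ℓ : Fin (2 ^ r) → ℝ) (p : CD r) (j : Fin (2 ^ r)) :
    diagL ℓ p j = ℓ j * p j := rfl

lemma norm_diagL_le {ℓ : Fin (2 ^ r) → ℝ} {M : ℝ} (hM : 0 ≤ M) (h : ∀ j, |ℓ j| ≤ M) (p : CD r) :
    ‖diagL ℓ p‖ ≤ M * ‖p‖ := by
  refine le_of_sq_le_sq ?_ (by positivity)
  rw [mul_pow, EuclideanSpace.real_norm_sq_eq, EuclideanSpace.real_norm_sq_eq, Finset.mul_sum]
  refine Finset.sum_le_sum fun j _ => ?_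
  rw [diagL_apply, mul_pow, ← sq_abs (ℓ j)]
  gcongr
  exact h j

lemma continuous_diagL {ℓ : (Fin n → ℝ) → Fin (2 ^ r) → ℝ} (hℓ : ∀ j, Continuous fun t => ℓ t j)
    (p : CD r) : Continuous fun t => diagL (ℓ t) p :=
  (PiLp.continuous_toLp 2 _).comp (continuous_pi fun j => (hℓ j).mul continuous_const)

lemma sum_Icc_smul_gen_apply (c : ℕ → ℝ) (j : Fin (2 ^ r)) :
    (∑ k ∈ Finset.Icc 1 (2 ^ r - 1), c k • gen r k) j = if j.1 = 0 then 0 else c j := by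
  have h2 := j.2
  rw [WithLp.ofLp_sum, Finset.sum_apply]
  simp only [gen, PiLp.smul_apply, smul_eq_mul, mul_ite, _root_.mul_one, mul_zero,
    Finset.sum_ite_eq, Finset.mem_Icc]
  split_ifs <;> first | rfl | omega

lemma coord_of_lt (z : CD r) {j : ℕ} (hj : j < 2 ^ r) : coord z j = z ⟨j, hj⟩ := dif_pos hj

lemma coord_zero (z : CD r) : coord z 0 = z ⟨0, by positivity⟩ := dif_pos _

/-- The coordinate `z_j` as a linear functional. -/
def coordL (r j : ℕ) : CD r →L[ℝ] ℝ :=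
  if h : j < 2 ^ r then EuclideanSpace.proj ⟨j, h⟩ else 0

lemma coordL_apply (z : CD r) (j : ℕ) : coordL r j z = coord z j := by
  unfold coordL coord
  split_ifs <;> rfl

lemma expType_expWeight_mul {ψ : CD r → ℝ} (h : ExpType (fun _ => 1) ψ) :
    ExpType expWeight fun x => expWeight x * ψ x := by
  have := (expType_exp (-coordL r 0)).mul h
  simpa [coordL_apply, coord_zero, expWeight] using! this

/-- The projection onto the purely imaginary numbers. -/
def imL (r : ℕ) : CD r →L[ℝ] CD r := diagL fun j => if j.1 = 0 then 0 else 1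

/-- In Cartesian coordinates `exp (-x) = e^{-x_0} (cos |X| - X sin |X| / |X|)`, `X` being the
imaginary part of `x`. -/
lemma exp_neg_eq (hr : 1 ≤ r) (x : CD r) : exp (-x) =
    (expWeight x * Real.cos ‖imL r x‖) • gen r 0 -
      (expWeight x * rsinc ‖imL r x‖) • imL r x := by
  have h0 : (-imL r x) ⟨0, by positivity⟩ = 0 := by simp [imL]
  obtain ⟨e, he, hm⟩ := exists_imaginary_unit hr h0
  have hx : -x = (-x ⟨0, by positivity⟩) • gen r 0 + ‖imL r x‖ • e := by
    rw [norm_neg] at hm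
    rw [← hm]
    ext j
    by_cases hj : j.1 = 0
    · have : j = ⟨0, by positivity⟩ := Fin.ext hj
      subst this
      simp [gen, imL]
    · have hj' : j ≠ 0 := fun h => hj (by simp [h])
      simp [gen, imL, hj']
  rw [hx, exp_add_smul he, ← rsinc_mul, sub_eq_add_neg, ← smul_neg, hm, norm_neg, smul_smul,
    ← _root_.mul_assoc]
  rfl

lemma expType_exp_neg (hr : 1 ≤ r) (j : Fin (2 ^ r)) :
    ExpType expWeight fun x => exp (-x) j := by
  have h := expType_expWeight_mul (((expType_cos_norm (imL r)).const_mul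
    (gen r 0 j)).add ((expType_sinc_norm_mul (imL r) j).const_mul (-1)) fun _ => zero_le_one)
  refine (iff_of_eq ?_).1 h
  congr 1
  ext1 x
  rw [exp_neg_eq hr]
  simp only [PiLp.sub_apply, PiLp.smul_apply, smul_eq_mul]
  ring

/-- The unit vector `i_1 cos θ_2 + i_2 sin θ_2 cos θ_3 + … + i_{2^r-1} sin θ_2 ⋯ sin θ_{2^r-1}`
of the spherical coordinates, with angles `θ_j = x_j`. -/
def sphN (x : CD r) : CD r :=
  ∑ k ∈ Finset.Icc 1 (2 ^ r - 2),
      ((∏ j ∈ Finset.Icc 2 k, Real.sin (coord x j)) * Real.cos (coord x (k + 1))) • gen r k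
    + (∏ j ∈ Finset.Icc 2 (2 ^ r - 1), Real.sin (coord x j)) • gen r (2 ^ r - 1)

lemma sum_sq_spherical (θ : ℕ → ℝ) (m : ℕ) :
    ∑ k ∈ Finset.Icc 1 m, ((∏ j ∈ Finset.Icc 2 k, Real.sin (θ j)) * Real.cos (θ (k + 1))) ^ 2
      + (∏ j ∈ Finset.Icc 2 (m + 1), Real.sin (θ j)) ^ 2 = 1 := by
  induction m with
  | zero => simp
  | succ m ih =>
    rw [Finset.sum_Icc_succ_top (by omega), Finset.prod_Icc_succ_top (b := m + 1) (by omega)]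
    rw [← ih, mul_pow, mul_pow, Real.sin_sq (θ (m + 1 + 1))]
    ring

/-- The coefficients of `sphN` with respect to the generators. -/
def sphCoeff (x : CD r) (k : ℕ) : ℝ :=
  if k = 2 ^ r - 1 then ∏ j ∈ Finset.Icc 2 k, Real.sin (coord x j)
  else (∏ j ∈ Finset.Icc 2 k, Real.sin (coord x j)) * Real.cos (coord x (k + 1))

lemma sphN_eq (hr : 1 ≤ r) (x : CD r) :
    sphN x = ∑ k ∈ Finset.Icc 1 (2 ^ r - 1), sphCoeff x k • gen r k := by
  have h2 : 2 ^ 1 ≤ 2 ^ r := Nat.pow_le_pow_right (by norm_num) hr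
  obtain ⟨m, hm⟩ : ∃ m, 2 ^ r = m + 2 := ⟨2 ^ r - 2, by omega⟩
  have e₁ : 2 ^ r - 1 = m + 1 := by omega
  have e₂ : 2 ^ r - 2 = m := by omega
  unfold sphN sphCoeff
  rw [e₁, e₂, Finset.sum_Icc_succ_top (by omega)]
  congr 1
  · refine Finset.sum_congr rfl fun k hk => ?_
    rw [Finset.mem_Icc] at hk
    rw [if_neg (by omega)]
  · rw [if_pos rfl]

lemma sphN_mul_self (hr : 1 ≤ r) (x : CD r) : mul (sphN x) (sphN x) = -gen r 0 := by
  have h2 : 2 ^ 1 ≤ 2 ^ r := Nat.pow_le_pow_right (by norm_num) hr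
  obtain ⟨m, hm⟩ : ∃ m, 2 ^ r = m + 2 := ⟨2 ^ r - 2, by omega⟩
  have e₁ : 2 ^ r - 1 = m + 1 := by omega
  have hN (j : Fin (2 ^ r)) : sphN x j = if j.1 = 0 then 0 else sphCoeff x j := by
    rw [sphN_eq hr, sum_Icc_smul_gen_apply]
  refine mul_self_of_imaginary (by simp [hN]) ?_
  rw [EuclideanSpace.norm_eq, Real.sqrt_eq_one]
  simp only [Real.norm_eq_abs, sq_abs, hN]
  rw [Fin.sum_univ_eq_sum_range (fun j => (if j = 0 then 0 else sphCoeff x j) ^ 2), hm,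
    Finset.sum_range_succ', ← sum_sq_spherical (coord x) m]
  simp only [Nat.add_eq_zero_iff, one_ne_zero, and_false, if_false, if_true]
  rw [zero_pow two_ne_zero, add_zero, Finset.sum_range_succ, Finset.range_eq_Ico,
    Finset.sum_Ico_add' (fun k => sphCoeff x k ^ 2) 0 m 1]
  congr 1
  · refine Finset.sum_congr (by ext; simp [Nat.succ_le_iff]) fun k hk => ?_
    simp only [Finset.mem_Icc] at hk
    rw [sphCoeff, if_neg (by omega)]
  · rw [sphCoeff, if_pos e₁.symm]

/-- The exponential `exp (-u)` in spherical coordinates, as a function of `x_j = p_j s_j + ζ_j`. -/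
def expSph (x : CD r) : CD r := exp (-(x ⟨0, by positivity⟩ • gen r 0 + coord x 1 • sphN x))

lemma expSph_eq (hr : 1 ≤ r) (x : CD r) : expSph x =
    (expWeight x * Real.cos (coord x 1)) • gen r 0 -
      (expWeight x * Real.sin (coord x 1)) • sphN x := by
  rw [expSph, neg_add, ← neg_smul, ← neg_smul, exp_add_smul (sphN_mul_self hr x), Real.cos_neg,
    Real.sin_neg, mul_neg, neg_smul, ← sub_eq_add_neg]
  rfl

lemma expType_sphN (j : Fin (2 ^ r)) : ExpType (fun _ => 1) fun x : CD r => sphN x j := by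
  have hs (k : ℕ) : ExpType (fun _ => 1) fun x : CD r => Real.sin (coord x k) := by
    simpa only [coordL_apply] using expType_sin (coordL r k)
  have hc (k : ℕ) : ExpType (fun _ => 1) fun x : CD r => Real.cos (coord x k) := by
    simpa only [coordL_apply] using expType_cos (coordL r k)
  have hp (k : ℕ) := ExpType.prod (Finset.Icc 2 k) fun j _ => hs j
  have h := (ExpType.sum (Finset.Icc 1 (2 ^ r - 2)) fun k _ =>
    ((hp k).mul_one_weight (hc (k + 1))).const_mul (gen r k j)).add
    ((hp (2 ^ r - 1)).const_mul (gen r (2 ^ r - 1) j)) fun _ => zero_le_one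
  refine (iff_of_eq ?_).1 h
  congr 1
  ext1 x
  simp [sphN, mul_comm]

lemma expType_expSph (hr : 1 ≤ r) (j : Fin (2 ^ r)) : ExpType expWeight fun x => expSph x j := by
  have hs : ExpType (fun _ => 1) fun x : CD r => Real.sin (coord x 1) := by
    simpa only [coordL_apply] using expType_sin (coordL r 1)
  have hc : ExpType (fun _ => 1) fun x : CD r => Real.cos (coord x 1) := by
    simpa only [coordL_apply] using expType_cos (coordL r 1)
  have h := expType_expWeight_mul ((hc.const_mul (gen r 0 j)).add
    ((hs.const_mul (-1)).mul_one_weight (expType_sphN j)) fun _ => zero_le_one)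
  refine (iff_of_eq ?_).1 h
  congr 1
  ext1 x
  rw [expSph_eq hr]
  simp only [PiLp.sub_apply, PiLp.smul_apply, smul_eq_mul]
  ring

lemma continuous_tc (j : ℕ) : Continuous fun t : Fin n → ℝ => tc t j := by
  unfold tc
  split_ifs <;> fun_prop

lemma continuous_sc (j : ℕ) : Continuous fun t : Fin n → ℝ => sc t j :=
  continuous_finsetSum _ fun k _ => continuous_tc k

lemma sum_tc (t : Fin n → ℝ) : ∑ j ∈ Finset.Icc 1 n, tc t j = ∑ j, t j := by
  have h : Finset.Icc 1 n = Finset.Ico (0 + 1) (n + 1) := by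
    ext
    simp
  rw [h, ← Finset.sum_Ico_add' (fun j => tc t j) 0 n 1, ← Finset.range_eq_Ico,
    ← Fin.sum_univ_eq_sum_range (fun j => tc t (j + 1))]
  refine Finset.sum_congr rfl fun j _ => ?_
  have : 1 ≤ j.1 + 1 ∧ j.1 + 1 ≤ n := by omega
  simp [tc, this]

lemma abs_tc (t : Fin n → ℝ) (j : ℕ) : |tc t j| = tc (fun i => |t i|) j := by
  unfold tc
  split_ifs <;> simp

lemma abs_sc_le (t : Fin n → ℝ) {j : ℕ} (hj : 1 ≤ j) : |sc t j| ≤ absSum t := by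
  calc |sc t j| ≤ ∑ k ∈ Finset.Icc j n, |tc t k| := Finset.abs_sum_le_sum_abs _ _
    _ ≤ ∑ k ∈ Finset.Icc 1 n, |tc t k| :=
        Finset.sum_le_sum_of_subset_of_nonneg (Finset.Icc_subset_Icc_left hj)
          fun _ _ _ => abs_nonneg _
    _ = absSum t := by simp only [abs_tc, sum_tc, absSum]

lemma abs_tc_le (t : Fin n → ℝ) (j : ℕ) : |tc t j| ≤ absSum t := by
  unfold tc
  split_ifs with h
  · exact Finset.single_le_sum (fun i _ => abs_nonneg (t i)) (Finset.mem_univ _)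
  · simpa using absSum_nonneg t

/-- The factors `t_1 + … + t_n` of `p_0` and `t_j` of `p_j` in Cartesian coordinates. -/
def cartFactor (r : ℕ) (t : Fin n → ℝ) (j : Fin (2 ^ r)) : ℝ :=
  if j.1 = 0 then ∑ i, t i else tc t j

/-- The factors `s_1` of `p_0` and `s_j` of `p_j` in spherical coordinates. -/
def sphFactor (r : ℕ) (t : Fin n → ℝ) (j : Fin (2 ^ r)) : ℝ :=
  if j.1 = 0 then ∑ i, t i else sc t j

lemma uCart_eq (p : CD r) (t : Fin n → ℝ) (ζ : CD r) :
    uCart p t ζ = diagL (cartFactor r t) p + ζ := by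
  ext j
  simp only [uCart, PiLp.add_apply, PiLp.smul_apply, sum_Icc_smul_gen_apply, diagL_apply,
    cartFactor, sum_tc, coord_zero]
  by_cases hj : j.1 = 0
  · have : j = ⟨0, by positivity⟩ := Fin.ext hj
    subst this
    simp [gen, mul_comm]
  · have hj' : j ≠ 0 := fun h => hj (by simp [h])
    simp [gen, hj', coord_of_lt p j.2, mul_comm]

lemma coord_diagL_sphFactor (p : CD r) (t : Fin n → ℝ) (ζ : CD r) {j : ℕ} (hj : j ≠ 0) :
    coord (diagL (sphFactor r t) p + ζ) j = angle p t ζ j := by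
  unfold angle
  by_cases h : j < 2 ^ r
  · simp [coord_of_lt _ h, sphFactor, hj, mul_comm]
  · simp [coord, h]

lemma exp_neg_uSph (p : CD r) (t : Fin n → ℝ) (ζ : CD r) :
    exp (-uSph p t ζ) = expSph (diagL (sphFactor r t) p + ζ) := by
  unfold expSph uSph
  have hM : sphM p t ζ = coord (diagL (sphFactor r t) p + ζ) 1 •
      sphN (diagL (sphFactor r t) p + ζ) := by
    rw [coord_diagL_sphFactor p t ζ one_ne_zero, sphM, sphN]
    have hp (k : ℕ) : ∏ j ∈ Finset.Icc 2 k, Real.sin (angle p t ζ j) = ∏ j ∈ Finset.Icc 2 k,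
        Real.sin (coord (diagL (sphFactor r t) p + ζ) j) := by
      refine Finset.prod_congr rfl fun j hj => ?_
      rw [Finset.mem_Icc] at hj
      rw [coord_diagL_sphFactor p t ζ (by omega)]
    simp only [hp, coord_diagL_sphFactor p t ζ (Nat.succ_ne_zero _)]
  have h0 : (diagL (sphFactor r t) p + ζ) ⟨0, by positivity⟩ =
      coord p 0 * sc t 1 + coord ζ 0 := by
    simp only [PiLp.add_apply, diagL_apply, sphFactor, if_true, coord_zero, sc, sum_tc]
    ring
  rw [h0, ← hM, add_smul]
  congr 2
  abel

/-- For `r = 1` both coordinate systems give `u = p t + ζ`. -/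
lemma uSph_eq_uCart (p : CD 1) (t : Fin 1 → ℝ) (ζ : CD 1) : uSph p t ζ = uCart p t ζ := by
  ext j
  change Fin 2 at j
  fin_cases j <;> simp [uSph, uCart, sphM, angle, gen, coord, sc]

end Factorization

/-! ### Laplace transforms -/

section Laplace

variable {r n : ℕ} {f : (Fin n → ℝ) → CD r} {a₁ am₁ : ℝ}

/-- `exp (-u(p,t;ζ))` is a function `Ψ` of the numbers `x_j = ℓ_j(t) p_j + ζ_j`, whose components
are of exponential type with weight `e^{-x_0}`; the factor of `p_0` is `t_1 + … + t_n`. -/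
structure IsPhase (u : CD r → (Fin n → ℝ) → CD r → CD r) (ℓ : (Fin n → ℝ) → Fin (2 ^ r) → ℝ)
    (Ψ : CD r → CD r) : Prop where
  expType : ∀ j, ExpType expWeight fun x => Ψ x j
  exp_neg : ∀ p t ζ, exp (-u p t ζ) = Ψ (diagL (ℓ t) p + ζ)
  continuous : ∀ j, Continuous fun t => ℓ t j
  apply_zero : ∀ t, ℓ t ⟨0, by positivity⟩ = ∑ i, t i
  abs_le : ∀ t j, |ℓ t j| ≤ absSum t

lemma isPhase_uCart (hr : 1 ≤ r) :
    IsPhase (uCart (r := r) (n := n)) (cartFactor r) (fun x => exp (-x)) where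
  expType := expType_exp_neg hr
  exp_neg p t ζ := by rw [uCart_eq]
  continuous j := by
    unfold cartFactor
    split_ifs
    · fun_prop
    · exact continuous_tc _
  apply_zero t := by simp [cartFactor]
  abs_le t j := by
    unfold cartFactor
    split_ifs
    · exact Finset.abs_sum_le_sum_abs _ _
    · exact abs_tc_le t _

lemma isPhase_uSph (hr : 1 ≤ r) :
    IsPhase (uSph (r := r) (n := n)) (sphFactor r) expSph where
  expType := expType_expSph hr
  exp_neg := exp_neg_uSph
  continuous j := by
    unfold sphFactor
    split_ifs
    · fun_prop
    · exact continuous_sc _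
  apply_zero t := by simp [sphFactor]
  abs_le t j := by
    unfold sphFactor
    split_ifs with h
    · exact Finset.abs_sum_le_sum_abs _ _
    · exact abs_sc_le t (Nat.one_le_iff_ne_zero.2 h)

variable {u : CD r → (Fin n → ℝ) → CD r → CD r} {ℓ : (Fin n → ℝ) → Fin (2 ^ r) → ℝ}
  {Ψ : CD r → CD r}

lemma IsPhase.integrand_eq (h : IsPhase u ℓ Ψ) (p ζ : CD r) : integrand f u p ζ =
    fun t => ∑ j : Fin (2 ^ r), Ψ (diagL (ℓ t) p + ζ) j • mul (f t) (gen r j.1) := by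
  ext1 t
  rw [integrand, h.exp_neg]
  conv_lhs => rw [← sum_smul_gen (Ψ (diagL (ℓ t) p + ζ)), mul_sum]
  simp only [mul_smul]

lemma IsPhase.continuous_arg (h : IsPhase u ℓ Ψ) (p ζ : CD r) :
    Continuous fun t => diagL (ℓ t) p + ζ :=
  (continuous_diagL h.continuous p).add continuous_const

lemma IsPhase.arg_zero (h : IsPhase u ℓ Ψ) (p ζ : CD r) (t : Fin n → ℝ) :
    (diagL (ℓ t) p + ζ) ⟨0, by positivity⟩ =
      p ⟨0, by positivity⟩ * ∑ i, t i + ζ ⟨0, by positivity⟩ := by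
  rw [PiLp.add_apply, diagL_apply, h.apply_zero, mul_comm]

lemma mem_strip {p : CD r} : p ∈ strip r a₁ am₁ ↔
    a₁ < p ⟨0, by positivity⟩ ∧ p ⟨0, by positivity⟩ < am₁ := by
  rw [← coord_zero]
  rfl

lemma IsPhase.integrable_term (h : IsPhase u ℓ Ψ) (hf : IsOriginal f a₁ am₁) {p : CD r}
    (hp : p ∈ strip r a₁ am₁) (ζ : CD r) (j : Fin (2 ^ r)) :
    Integrable fun t => Ψ (diagL (ℓ t) p + ζ) j • mul (f t) (gen r j.1) := by
  rw [mem_strip] at hp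
  exact hf.integrable_smul_mul hp.1 hp.2 (h.expType j) (h.continuous_arg p ζ) (h.arg_zero p ζ) _

lemma IsPhase.integrable (h : IsPhase u ℓ Ψ) (hf : IsOriginal f a₁ am₁) {p : CD r}
    (hp : p ∈ strip r a₁ am₁) (ζ : CD r) : Integrable (integrand f u p ζ) := by
  rw [h.integrand_eq]
  exact integrable_finsetSum _ fun j _ => h.integrable_term hf hp ζ j

lemma IsPhase.image_eq (h : IsPhase u ℓ Ψ) (hf : IsOriginal f a₁ am₁) {p : CD r}
    (hp : p ∈ strip r a₁ am₁) (ζ : CD r) : image f u p ζ =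
      ∑ j : Fin (2 ^ r), ∫ t, Ψ (diagL (ℓ t) p + ζ) j • mul (f t) (gen r j.1) := by
  rw [image, h.integrand_eq]
  exact integral_finsetSum _ fun j _ => h.integrable_term hf hp ζ j

lemma isOpen_strip : IsOpen (strip r a₁ am₁) := by
  have hc : Continuous fun p : CD r => coord p 0 := by
    simp only [coord_zero]
    fun_prop
  exact (isOpen_lt continuous_const hc).inter (isOpen_lt hc continuous_const)

lemma IsPhase.holomorphicOn_fst (h : IsPhase u ℓ Ψ) (hr : 2 ≤ r) (hf : IsOriginal f a₁ am₁)
    (ζ : CD r) : HolomorphicOn (fun p => image f u p ζ) (strip r a₁ am₁) := by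
  intro p hp
  have hev : ∀ᶠ q in 𝓝 p, q ∈ strip r a₁ am₁ := isOpen_strip.mem_nhds hp
  refine HolomorphicAt.congr (HolomorphicAt.sum Finset.univ fun j _ => ?_)
    (hev.mono fun q hq => (h.image_eq hf hq ζ).symm)
  rw [mem_strip] at hp
  refine hf.holomorphicAt_integral hr hp.1 hp.2 (h.expType j) (h.continuous_arg p ζ)
    (h.arg_zero p ζ) (ℓ := fun t => diagL (ℓ t)) (continuous_diagL h.continuous)
    (fun t q => ?_) (gen r j.1) fun q => ?_
  · have := absSum_nonneg t
    exact norm_diagL_le (by positivity) (fun j => (h.abs_le t j).trans (by linarith)) q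
  · simp only [map_add, add_right_comm]

lemma IsPhase.holomorphicOn_snd (h : IsPhase u ℓ Ψ) (hr : 2 ≤ r) (hf : IsOriginal f a₁ am₁)
    {p : CD r} (hp : p ∈ strip r a₁ am₁) :
    HolomorphicOn (fun ζ => image f u p ζ) Set.univ := by
  intro ζ _
  refine HolomorphicAt.congr (HolomorphicAt.sum Finset.univ fun j _ => ?_)
    (.of_forall fun ζ' => (h.image_eq hf hp ζ').symm)
  rw [mem_strip] at hp
  refine hf.holomorphicAt_integral hr hp.1 hp.2 (h.expType j) (h.continuous_arg p ζ)
    (h.arg_zero p ζ) (ℓ := fun _ => ContinuousLinearMap.id ℝ _) (fun _ => continuous_const)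
    (fun t q => ?_) (gen r j.1) fun q => ?_
  · have := absSum_nonneg t
    rw [ContinuousLinearMap.id_apply]
    nlinarith [norm_nonneg q]
  · simp only [ContinuousLinearMap.id_apply, add_assoc]

lemma diagL_cartFactor_one (p : CD 1) (t : Fin 1 → ℝ) : diagL (cartFactor 1 t) p = t 0 • p := by
  ext j
  change Fin 2 at j
  fin_cases j <;> simp [cartFactor, tc]

lemma holomorphicOn_fst_one {f : (Fin 1 → ℝ) → CD 1} (hf : IsOriginal f a₁ am₁) (ζ : CD 1) :
    HolomorphicOn (fun p => image f uCart p ζ) (strip 1 a₁ am₁) := by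
  intro p hp
  have h := isPhase_uCart (r := 1) (n := 1) le_rfl
  rw [mem_strip] at hp
  change HolomorphicAt (fun p => image f uCart p ζ) p
  refine hf.holomorphicAt_integral_one hp.1 hp.2 (h.continuous_arg p ζ) (h.arg_zero p ζ)
    (s := fun t => t 0) (by fun_prop) (fun t => ?_) fun q => ?_
  · simp [absSum]
  · simp only [image, integrand, uCart_eq, diagL_cartFactor_one, smul_add, add_right_comm]

lemma holomorphicOn_snd_one {f : (Fin 1 → ℝ) → CD 1} (hf : IsOriginal f a₁ am₁) {p : CD 1}
    (hp : p ∈ strip 1 a₁ am₁) : HolomorphicOn (fun ζ => image f uCart p ζ) Set.univ := by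
  intro ζ _
  have h := isPhase_uCart (r := 1) (n := 1) le_rfl
  rw [mem_strip] at hp
  change HolomorphicAt (fun ζ => image f uCart p ζ) ζ
  refine hf.holomorphicAt_integral_one hp.1 hp.2 (h.continuous_arg p ζ) (h.arg_zero p ζ)
    (s := fun _ => 1) continuous_const (fun t => ?_) fun q => ?_
  · simpa using absSum_nonneg t
  · simp only [image, integrand, uCart_eq, one_smul, add_assoc]

end Laplace

end CD

end

theorem theorem4 (r n : ℕ) (hr : 1 ≤ r) (hn₁ : 2 ^ (r - 1) ≤ n) (hn₂ : n ≤ 2 ^ r - 1)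
    (f : (Fin n → ℝ) → CD r) (a₁ am₁ : ℝ) (hf : CD.IsOriginal f a₁ am₁) (ha : a₁ < am₁)
    (u : CD r → (Fin n → ℝ) → CD r → CD r) (hu : u = CD.uCart ∨ u = CD.uSph) :
    (∀ p ∈ CD.strip r a₁ am₁, ∀ ζ : CD r, MeasureTheory.Integrable (CD.integrand f u p ζ)) ∧
    (∀ ζ : CD r, CD.HolomorphicOn (fun p => CD.image f u p ζ) (CD.strip r a₁ am₁)) ∧
    (∀ p ∈ CD.strip r a₁ am₁, CD.HolomorphicOn (fun ζ => CD.image f u p ζ) Set.univ) := by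
  obtain ⟨ℓ, Ψ, h⟩ : ∃ ℓ Ψ, CD.IsPhase u ℓ Ψ := by
    rcases hu with rfl | rfl
    · exact ⟨_, _, CD.isPhase_uCart hr⟩
    · exact ⟨_, _, CD.isPhase_uSph hr⟩
  refine ⟨fun p hp ζ => h.integrable hf hp ζ, ?_⟩
  rcases hr.eq_or_lt with rfl | hr2
  · obtain rfl : n = 1 := le_antisymm hn₂ hn₁
    obtain rfl : u = CD.uCart := by
      rcases hu with rfl | rfl
      · rfl
      · ext1 p
        ext1 t
        ext1 ζ
        exact CD.uSph_eq_uCart p t ζ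
    exact ⟨CD.holomorphicOn_fst_one hf, fun p hp => CD.holomorphicOn_snd_one hf hp⟩
  · exact ⟨h.holomorphicOn_fst hr2 hf, fun p hp => h.holomorphicOn_snd hr2 hf hp⟩
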